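/- For a real number $X>0$ and an integer $q\ge 1$ put $$S_q(X)=\sum_{\substack{\ell\le X\\ (\ell,q)=1}}\frac{\mu^2(\ell)}{\varphi(\ell)},\qquad \mathfrak a_q=\sum_{p}\frac{\log p}{p(p-1)}+\gamma+\sum_{p\mid q}\frac{\log p}{p},$$ where $\ell$ runs over positive integers, $p$ over primes, and $\gamma$ is the Euler–Mascheroni constant. Let $$K(q)=4.4\cdot 0.493^{[2\mid q]}\cdot\prod_{p\mid q}\left(1+\frac{p-2}{p^{3/2}-p-\sqrt p+2}\right),$$ where $[2\mid q]$ is $1$ if $q$ is even and $0$ if $q$ is odd. Then: (i) for all real $X>0$ and all integers $q\ge 1$, $$\left|S_q(X)-\frac{\varphi(q)}{q}\bigl(\log X+\mathfrak a_q\bigr)\right|\le \frac{K(q)}{\sqrt X};$$ (ii) for $q=2$ and all real $X>0$, $$\left|S_2(X)-\frac12\bigl(\log X+\mathfrak a_2\bigr)\right|\le\frac{2.169}{\sqrt X};$$ (iii) for every prime $p$ one has $K(p)<5.9\,j(p)$, where $j(2)=\frac{21}{25}$ and $j(p)=1+\frac{p-2}{p^{3/2}-\sqrt p+1}$ for $p\ge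 3$; that is, for prime $q=p$ the error constant in (i) is smaller than the constant $5.9\,j(p)$ of Ramaré and Akhilesh. -/

import Mathlib

namespace SelbergSum

/-- The sum of `μ²(ℓ)/φ(ℓ)` over the positive integers `ℓ ≤ X` coprime to `q`. -/
noncomputable def S (q : ℕ) (X : ℝ) : ℝ :=
  ∑ l ∈ (Finset.Icc 1 ⌊X⌋₊).filter (fun l => Nat.Coprime l q),
    ((ArithmeticFunction.moebius l : ℤ) : ℝ) ^ 2 / (Nat.totient l : ℝ)

/-- The series over all primes in `𝔞 q` converges, so that its `∑'` is a genuine sum. -/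
theorem summable_log_div :
    Summable (fun p : Nat.Primes => Real.log (p : ℝ) / ((p : ℝ) * ((p : ℝ) - 1))) := by
  have h : Summable (fun n : ℕ => 4 * (1 / (n : ℝ) ^ (3 / 2 : ℝ))) :=
    (Real.summable_one_div_nat_rpow.2 (by norm_num)).mul_left 4
  refine Summable.of_nonneg_of_le (fun p => ?_) (fun p => ?_)
    (h.comp_injective Nat.Primes.coe_nat_injective)
  · have hp : (2 : ℝ) ≤ (p : ℕ) := by exact_mod_cast p.2.two_le
    have := Real.log_nonneg (by linarith : (1 : ℝ) ≤ (p : ℕ))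
    exact div_nonneg this (mul_nonneg (by linarith) (by linarith))
  · have hp : (2 : ℝ) ≤ (p : ℕ) := by exact_mod_cast p.2.two_le
    have hl := Real.log_le_rpow_div (x := ((p : ℕ) : ℝ)) (by linarith)
      (by norm_num : (0 : ℝ) < 1 / 2)
    have e : (((p : ℕ) : ℝ)) ^ (1 / 2 : ℝ) * ((p : ℕ) : ℝ) ^ (3 / 2 : ℝ)
        = ((p : ℕ) : ℝ) ^ 2 := by
      rw [← Real.rpow_add (by linarith)]; norm_num
    have h3 : 0 < ((p : ℕ) : ℝ) ^ (3 / 2 : ℝ) := Real.rpow_pos_of_pos (by linarith) _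
    simp only [Function.comp]
    rw [mul_one_div, div_le_div_iff₀ (mul_pos (by linarith) (by linarith)) h3]
    calc Real.log ((p : ℕ) : ℝ) * ((p : ℕ) : ℝ) ^ (3 / 2 : ℝ)
        ≤ (((p : ℕ) : ℝ) ^ (1 / 2 : ℝ) / (1 / 2)) * ((p : ℕ) : ℝ) ^ (3 / 2 : ℝ) := by gcongr
      _ = 2 * ((p : ℕ) : ℝ) ^ 2 := by rw [← e]; ring
      _ ≤ 4 * (((p : ℕ) : ℝ) * (((p : ℕ) : ℝ) - 1)) := by nlinarith

/-- `𝔞_q = ∑_p log p / (p (p - 1)) + γ + ∑_{p ∣ q} log p / p`. -/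
noncomputable def 𝔞 (q : ℕ) : ℝ :=
  (∑' p : Nat.Primes, Real.log (p : ℝ) / ((p : ℝ) * ((p : ℝ) - 1)))
    + Real.eulerMascheroniConstant
    + ∑ p ∈ q.primeFactors, Real.log (p : ℝ) / (p : ℝ)

/-- The numerator of the error term: the product over the primes `p ∣ q` of
`1 + (p - 2) / (p^(3/2) - p - √p + 2)`, times `4.4`, times `0.493` if `q` is even. -/
noncomputable def errConst (q : ℕ) : ℝ :=
  (∏ p ∈ q.primeFactors,
      (1 + ((p : ℝ) - 2) / ((p : ℝ) ^ (3 / 2 : ℝ) - (p : ℝ) - √(p : ℝ) + 2)))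
    * (4.4 * (if 2 ∣ q then 0.493 else 1))

/-- The factor at a prime `p` of the earlier error term `5.9 ∏_{p ∣ q} j(p) / √X` due to
Ramaré and Akhilesh. -/
noncomputable def j (p : ℕ) : ℝ :=
  if p = 2 then 21 / 25
  else 1 + ((p : ℝ) - 2) / ((p : ℝ) ^ (3 / 2 : ℝ) - √(p : ℝ) + 1)

end SelbergSum

/-!
The function `n ↦ μ²(n) / φ(n)` on integers coprime to `q` is compared with `n ↦ 1 / n` on
integers coprime to `6`. The sum `H6` of the latter is `(log X + κ0) / 3` up to an error of at
most `0.75 / X` for `X ≥ 1` (`abs_ε6_le`).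

Removing the square factors of primes `p ≥ 5` gives `α (log y + β)` with an error that is a sum
over `d` coprime to `6` of values of the error of `H6` at `y / d ^ 2`. Summed trivially, without
any cancellation from the Möbius function, this is at most `0.55 / √y` for `y ≥ 25`
(`abs_E6_le_of_ge`). Together with the finitely many jumps below `25` and the explicit main term
below `1`, this describes the error at all scales (`errorProfile_E6`).

Then the primes receive their weights from `S q` one after the other. For `2` and `3` this is a
finite combination of values at `X`, `X / 2`, `X / 3`, `X / 6`; estimating it as a whole
(`abs_two_three_combination_le`) saves the constant that prime-by-prime estimates at `2` and `3`
would lose. For a prime `p ≥ 5` the error constant is multiplied by `1 + η p` if `p ∤ q` and by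
`√p / (√p - 1)` if `p ∣ q` (`HasLogMain.add_div`, `HasLogMain.of_add_div`). The second factor is
`1 + η p` times the factor of `errConst q` at `p`, so the claim reduces to the numerical bound
`∏ (1 + η p) ≤ 1.77` over the primes `p ≥ 5` (`prod_one_add_η_le`).

Only the primes below a bound `N` are treated, so all products and sums are finite; if `N` exceeds
`X` the sum over `n ≤ X` is exactly `S q X`, and `N → ∞` turns the finite sum over primes in the
main term into the series in `𝔞 q`.
-/

namespace SelbergSum

/-! ### Weighted sums and their recursions -/

/-- The multiplicative function `n ↦ ∏_{p ^ k ∥ n} w p ^ k`, cut off to those `n` that are not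
divisible by `p ^ 2` for any `p ∈ s`. Only square factors at the primes of the finite set `s` are
removed, so that the local factors can be treated one prime at a time. -/
noncomputable def coef (s : Finset ℕ) (w : ℕ → ℝ) (n : ℕ) : ℝ :=
  open Classical in
  if ∀ p ∈ s, ¬ p ^ 2 ∣ n then n.factorization.prod (fun p k => w p ^ k) else 0

/-- The summatory function `∑_{n ≤ X} coef s w n`. -/
noncomputable def wsum (s : Finset ℕ) (w : ℕ → ℝ) (X : ℝ) : ℝ :=
  ∑ n ∈ Finset.Icc 1 ⌊X⌋₊, coef s w n

theorem sum_Icc_dvd (f : ℕ → ℝ) (M : ℕ) {p : ℕ} (hp : 0 < p) :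
    ∑ n ∈ (Finset.Icc 1 M).filter (p ∣ ·), f n = ∑ m ∈ Finset.Icc 1 (M / p), f (p * m) := by
  refine Finset.sum_nbij' (fun n => n / p) (fun m => p * m) ?_ ?_ ?_ ?_ ?_
  · intro n hn
    simp only [Finset.mem_filter, Finset.mem_Icc] at hn ⊢
    obtain ⟨⟨h1, h2⟩, h3⟩ := hn
    exact ⟨Nat.div_pos (Nat.le_of_dvd h1 h3) hp, Nat.div_le_div_right h2⟩
  · intro m hm
    simp only [Finset.mem_filter, Finset.mem_Icc] at hm ⊢
    refine ⟨⟨Nat.mul_pos hp hm.1, ?_⟩, dvd_mul_right _ _⟩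
    calc p * m ≤ p * (M / p) := Nat.mul_le_mul_left _ hm.2
      _ ≤ M := Nat.mul_div_le _ _
  · intro n hn
    exact Nat.mul_div_cancel' (Finset.mem_filter.1 hn).2
  · intro m _
    exact Nat.mul_div_cancel_left _ hp
  · intro n hn
    rw [Nat.mul_div_cancel' (Finset.mem_filter.1 hn).2]

theorem factorization_prod_prime_mul (w : ℕ → ℝ) {p m : ℕ} (hp : p.Prime) (hm : m ≠ 0) :
    (p * m).factorization.prod (fun p k => w p ^ k)
      = w p * m.factorization.prod (fun p k => w p ^ k) := by
  rw [Nat.factorization_mul hp.ne_zero hm, Finsupp.prod_add_index' (by simp)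
    (by intro a b c; exact pow_add _ _ _), hp.factorization, Finsupp.prod_single_index (by simp),
    pow_one]

theorem coef_update_of_not_dvd (s : Finset ℕ) (w : ℕ → ℝ) {p n : ℕ} (v : ℝ) (h : ¬ p ∣ n) :
    coef s (Function.update w p v) n = coef s w n := by
  unfold coef
  congr 1
  refine Finsupp.prod_congr fun q hq => ?_
  have : q ≠ p := by
    rintro rfl
    exact h (Nat.dvd_of_mem_primeFactors (by simpa using hq))
  simp [this]

theorem coef_eq_zero_of_dvd (s : Finset ℕ) (w : ℕ → ℝ) {p n : ℕ} (hp : p.Prime) (hn : n ≠ 0)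
    (h : p ∣ n) (hw : w p = 0) : coef s w n = 0 := by
  obtain ⟨m, rfl⟩ := h
  unfold coef
  rw [factorization_prod_prime_mul w hp (by rintro rfl; simp at hn), hw]
  simp

theorem coef_prime_mul (s : Finset ℕ) (hs : ∀ q ∈ s, q.Prime) (w : ℕ → ℝ) {p m : ℕ}
    (hp : p.Prime) (hm : m ≠ 0) (hpm : ¬ p ∣ m) : coef s w (p * m) = w p * coef s w m := by
  have key : (∀ q ∈ s, ¬ q ^ 2 ∣ p * m) ↔ ∀ q ∈ s, ¬ q ^ 2 ∣ m := by
    refine forall₂_congr fun q hq => not_congr ?_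
    by_cases hqp : q = p
    · subst hqp
      constructor
      · intro h
        exact absurd ((Nat.mul_dvd_mul_iff_left hp.pos).1 (by simpa [sq] using h)) hpm
      · exact fun h => dvd_mul_of_dvd_right h _
    · have hc : Nat.Coprime (q ^ 2) p :=
        Nat.Coprime.pow_left _ ((Nat.coprime_primes (hs q hq) hp).2 hqp)
      exact ⟨fun h => hc.dvd_of_dvd_mul_left h, fun h => dvd_mul_of_dvd_right h _⟩
  unfold coef
  rw [factorization_prod_prime_mul w hp hm]
  by_cases h : ∀ q ∈ s, ¬ q ^ 2 ∣ m
  · rw [if_pos h, if_pos (key.2 h)]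
  · rw [if_neg h, if_neg (fun h' => h (key.1 h')), mul_zero]

theorem coef_sq_dvd (s : Finset ℕ) (w : ℕ → ℝ) {p n : ℕ} (hp : p ∈ s) (h : p ^ 2 ∣ n) :
    coef s w n = 0 := by
  unfold coef
  rw [if_neg]
  push Not
  exact ⟨p, hp, h⟩

/-- Changing the weight at one prime `p ∈ s`: the summands divisible by `p` are `p * m` with
`p ∤ m`, because `p ^ 2` never divides an index in the support. -/
theorem wsum_eq_update (s : Finset ℕ) (hs : ∀ q ∈ s, q.Prime) (w : ℕ → ℝ) {p : ℕ} (hp : p ∈ s)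
    (X : ℝ) : wsum s w X = wsum s (Function.update w p 0) X
      + w p * wsum s (Function.update w p 0) (X / p) := by
  have hpp := hs p hp
  unfold wsum
  rw [Nat.floor_div_natCast, ← Finset.sum_filter_add_sum_filter_not _ (p ∣ ·),
    sum_Icc_dvd _ _ hpp.pos, add_comm, Finset.mul_sum]
  congr 1
  · rw [Finset.sum_filter]
    refine Finset.sum_congr rfl fun n hn => ?_
    have hn0 : n ≠ 0 := by have := (Finset.mem_Icc.1 hn).1; omega
    split_ifs with h
    · rw [coef_eq_zero_of_dvd s _ hpp hn0 h (by simp)]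
    · rw [coef_update_of_not_dvd s w 0 h]
  · refine Finset.sum_congr rfl fun m hm => ?_
    have hm0 : m ≠ 0 := by have := (Finset.mem_Icc.1 hm).1; omega
    by_cases h : p ∣ m
    · rw [coef_eq_zero_of_dvd s (Function.update w p 0) hpp hm0 h (by simp), mul_zero]
      refine coef_sq_dvd s w hp ?_
      rw [sq]
      exact Nat.mul_dvd_mul_left _ h
    · rw [coef_update_of_not_dvd s w 0 h, coef_prime_mul s hs w hpp hm0 h]

/-- Sieving out the multiples of `p ^ 2`: they are the `p ^ 2 * m` with `m` arbitrary in the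
previous support, since `p` is not yet in `s`. -/
theorem wsum_insert (s : Finset ℕ) (hs : ∀ q ∈ s, q.Prime) (w : ℕ → ℝ) {p : ℕ} (hp : p.Prime)
    (hps : p ∉ s) (X : ℝ) :
    wsum (insert p s) w X = wsum s w X - w p ^ 2 * wsum s w (X / (p : ℝ) ^ 2) := by
  have hp2 : 0 < p ^ 2 := pow_pos hp.pos 2
  have key : ∑ n ∈ (Finset.Icc 1 ⌊X⌋₊).filter (p ^ 2 ∣ ·), coef s w n
      = w p ^ 2 * wsum s w (X / (p : ℝ) ^ 2) := by
    rw [sum_Icc_dvd _ _ hp2, wsum, ← Nat.cast_pow, Nat.floor_div_natCast, Finset.mul_sum]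
    refine Finset.sum_congr rfl fun m hm => ?_
    have hm0 : m ≠ 0 := by have := (Finset.mem_Icc.1 hm).1; omega
    have key : (∀ q ∈ s, ¬ q ^ 2 ∣ p ^ 2 * m) ↔ ∀ q ∈ s, ¬ q ^ 2 ∣ m := by
      refine forall₂_congr fun q hq => not_congr ?_
      have hqp : q ≠ p := by rintro rfl; exact hps hq
      have hc : Nat.Coprime (q ^ 2) (p ^ 2) :=
        Nat.Coprime.pow _ _ ((Nat.coprime_primes (hs q hq) hp).2 hqp)
      exact ⟨fun h => hc.dvd_of_dvd_mul_left h, fun h => dvd_mul_of_dvd_right h _⟩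
    unfold coef
    rw [sq, mul_assoc, factorization_prod_prime_mul w hp (mul_ne_zero hp.ne_zero hm0),
      factorization_prod_prime_mul w hp hm0, ← mul_assoc p, ← sq, ← mul_assoc, ← sq]
    by_cases h : ∀ q ∈ s, ¬ q ^ 2 ∣ m
    · rw [if_pos h, if_pos (key.2 h)]
    · rw [if_neg h, if_neg (fun h' => h (key.1 h')), mul_zero]
  rw [← key, eq_sub_iff_add_eq]
  unfold wsum
  rw [Finset.sum_filter, ← Finset.sum_add_distrib]
  refine Finset.sum_congr rfl fun n _ => ?_
  by_cases h : p ^ 2 ∣ n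
  · rw [if_pos h, coef_sq_dvd _ _ (Finset.mem_insert_self p s) h, zero_add]
  · rw [if_neg h, add_zero]
    unfold coef
    simp [h]

theorem wsum_of_lt_one (s : Finset ℕ) (w : ℕ → ℝ) {X : ℝ} (hX : X < 1) : wsum s w X = 0 := by
  simp [wsum, Nat.floor_eq_zero.2 hX]

/-- Once `s` contains all primes up to `X`, square-freeness at the primes of `s` is
square-freeness for all `n ≤ X`, and the sum `S q X` is a `wsum` with no limit process involved.
-/
theorem S_eq_wsum (q : ℕ) {X : ℝ} {s : Finset ℕ} (hs : ∀ p ∈ s, p.Prime)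
    (hsX : ∀ p : ℕ, p.Prime → p ≤ ⌊X⌋₊ → p ∈ s) {w : ℕ → ℝ}
    (hw : ∀ p ∈ s, w p = if p ∣ q then 0 else 1 / ((p : ℝ) - 1)) : S q X = wsum s w X := by
  unfold S wsum
  rw [Finset.sum_filter]
  refine Finset.sum_congr rfl fun n hn => ?_
  obtain ⟨hn1, hn2⟩ := Finset.mem_Icc.1 hn
  have hn0 : n ≠ 0 := by omega
  have mem_s : ∀ p ∈ n.primeFactors, p ∈ s := fun p hp =>
    hsX p (Nat.prime_of_mem_primeFactors hp) ((Nat.le_of_mem_primeFactors hp).trans hn2)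
  by_cases hsq : Squarefree n
  · have h1 : coef s w n = ∏ p ∈ n.primeFactors, w p := by
      unfold coef
      rw [if_pos]
      · refine Finset.prod_congr rfl fun p hp => ?_
        have hp' : p ∈ n.primeFactors := hp
        rw [(hsq.natFactorization_le_one p).antisymm
          ((Nat.prime_of_mem_primeFactors hp').factorization_pos_of_dvd hn0
            (Nat.dvd_of_mem_primeFactors hp'))]
        exact pow_one _
      · intro p hp h
        exact (hs p hp).not_isUnit (hsq p (by rwa [← sq]))
    rw [h1]
    by_cases hc : n.Coprime q
    · rw [if_pos hc]
      have h2 : ((ArithmeticFunction.moebius n : ℤ) : ℝ) ^ 2 = 1 := by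
        have := ArithmeticFunction.moebius_sq_eq_one_of_squarefree hsq
        exact_mod_cast this
      rw [h2, Nat.totient_eq_prod_factorization hn0, Finsupp.prod, Nat.cast_prod, one_div,
        ← Finset.prod_inv_distrib]
      refine Finset.prod_congr rfl fun p hp => ?_
      have hp' : p ∈ n.primeFactors := hp
      have hpp := Nat.prime_of_mem_primeFactors hp'
      rw [(hsq.natFactorization_le_one p).antisymm (hpp.factorization_pos_of_dvd hn0
            (Nat.dvd_of_mem_primeFactors hp')), hw p (mem_s p hp'), if_neg]
      · simp [Nat.cast_sub hpp.one_le]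
      · intro h
        exact hpp.not_isUnit (Nat.isUnit_iff.2 (Nat.eq_one_of_dvd_coprimes hc
          (Nat.dvd_of_mem_primeFactors hp') h))
    · rw [if_neg hc]
      obtain ⟨p, hp, hpn, hpq⟩ := Nat.Prime.not_coprime_iff_dvd.1 hc
      have hp' : p ∈ n.primeFactors := Nat.mem_primeFactors.2 ⟨hp, hpn, hn0⟩
      rw [Finset.prod_eq_zero hp']
      rw [hw p (mem_s p hp'), if_pos hpq]
  · have h1 : coef s w n = 0 := by
      obtain ⟨p, hp, hpn⟩ : ∃ p, p.Prime ∧ p * p ∣ n := by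
        have := mt Nat.squarefree_iff_prime_squarefree.2 hsq
        push Not at this
        exact this
      refine coef_sq_dvd s w (p := p) (mem_s p ?_) (by rwa [sq])
      exact Nat.mem_primeFactors.2 ⟨hp, dvd_of_mul_left_dvd hpn, hn0⟩
    rw [h1, ArithmeticFunction.moebius_eq_zero_of_not_squarefree hsq]
    simp

/-! ### The harmonic sum over integers coprime to 6 -/

/-- Two terms of the `artanh` series, `log (b / a) = 2 artanh ((b - a) / (a + b))`. -/
theorem log_ratio_lower {a b : ℝ} (ha : 0 < a) (hab : a ≤ b) :
    2 * ((b - a) / (a + b)) + 2 / 3 * ((b - a) / (a + b)) ^ 3 ≤ Real.log (b / a) := by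
  have hs : 0 < a + b := by linarith
  have h0 : 0 ≤ (b - a) / (a + b) := div_nonneg (by linarith) hs.le
  have h1 : (b - a) / (a + b) < 1 := by rw [div_lt_one hs]; linarith
  have h := Real.sum_range_le_log_div h0 h1 2
  have e : (1 + (b - a) / (a + b)) / (1 - (b - a) / (a + b)) = b / a := by
    rw [show 1 + (b - a) / (a + b) = 2 * b / (a + b) by field_simp; ring,
      show 1 - (b - a) / (a + b) = 2 * a / (a + b) by field_simp; ring]
    field_simp
  rw [e] at h
  simp only [Finset.sum_range_succ, Finset.sum_range_zero] at h
  norm_num at h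
  linarith

theorem log_ratio_upper {a b : ℝ} (ha : 0 < a) (hab : a ≤ b) :
    Real.log (b / a) ≤ 2 * ((b - a) / (a + b)) + 2 / 3 * ((b - a) / (a + b)) ^ 3
      + 2 * ((b - a) / (a + b)) ^ 5 / (1 - ((b - a) / (a + b)) ^ 2) := by
  have hs : 0 < a + b := by linarith
  have h0 : 0 ≤ (b - a) / (a + b) := div_nonneg (by linarith) hs.le
  have h1 : (b - a) / (a + b) < 1 := by rw [div_lt_one hs]; linarith
  have h := Real.log_div_le_sum_range_add h0 h1 2
  have e : (1 + (b - a) / (a + b)) / (1 - (b - a) / (a + b)) = b / a := by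
    rw [show 1 + (b - a) / (a + b) = 2 * b / (a + b) by field_simp; ring,
      show 1 - (b - a) / (a + b) = 2 * a / (a + b) by field_simp; ring]
    field_simp
  rw [e] at h
  simp only [Finset.sum_range_succ, Finset.sum_range_zero] at h
  norm_num at h
  have e2 : 2 * ((b - a) / (a + b)) ^ 5 / (1 - ((b - a) / (a + b)) ^ 2)
    = 2 * (((b - a) / (a + b)) ^ 5 / (1 - ((b - a) / (a + b)) ^ 2)) := by ring
  rw [e2]
  linarith

/-- The weights of `1 / n` on integers coprime to `6`: the primes `2` and `3` get weight `0`. -/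
noncomputable def w6 (p : ℕ) : ℝ := if p = 2 ∨ p = 3 then 0 else 1 / p

/-- The sum of `1 / n` over `n ≤ X` coprime to `6`. -/
noncomputable def H6 (X : ℝ) : ℝ := wsum ∅ w6 X

/-- The sum of `1 / n` over the first `k` blocks `{6 i + 1, 6 i + 5}` of integers coprime to `6`.
-/
noncomputable def sixSum (k : ℕ) : ℝ :=
  ∑ i ∈ Finset.range k, (1 / (6 * (i : ℝ) + 1) + 1 / (6 * (i : ℝ) + 5))

/-- The constant of `H6`, namely `H6 X = (log X + κ0) / 3 + O(1 / X)`. -/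
noncomputable def κ0 : ℝ := Real.eulerMascheroniConstant + Real.log 2 + Real.log 3 / 2

theorem coprime_six_iff (n : ℕ) : n.Coprime 6 ↔ n % 6 = 1 ∨ n % 6 = 5 := by
  have h : n.Coprime 6 ↔ (n % 6).Coprime 6 := by
    unfold Nat.Coprime
    rw [Nat.gcd_comm, Nat.gcd_rec]
  rw [h]
  have : n % 6 < 6 := Nat.mod_lt _ (by norm_num)
  interval_cases n % 6 <;> decide

theorem coef_empty_w6 {n : ℕ} (hn : n ≠ 0) :
    coef ∅ w6 n = if n % 6 = 1 ∨ n % 6 = 5 then 1 / (n : ℝ) else 0 := by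
  split_ifs with h <;> rw [← coprime_six_iff] at h
  · unfold coef
    rw [if_pos (by simp)]
    have h1 : n.factorization.prod (fun p k => w6 p ^ k)
        = n.factorization.prod (fun p k => ((p ^ k : ℕ) : ℝ)⁻¹) := by
      refine Finsupp.prod_congr fun p hp => ?_
      have hp' : p ∈ n.primeFactors := hp
      have hpn := Nat.dvd_of_mem_primeFactors hp'
      have h6 : Nat.Coprime p 6 := Nat.Coprime.coprime_dvd_left hpn h
      have h2 : ¬ (p = 2 ∨ p = 3) := by
        rintro (rfl | rfl) <;> revert h6 <;> decide
      simp [w6, h2]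
    rw [h1, Finsupp.prod, Finset.prod_inv_distrib, ← Nat.cast_prod, one_div]
    congr 2
    exact Nat.prod_factorization_pow_eq_self hn
  · obtain ⟨p, hp, hpn, hp6⟩ := Nat.Prime.not_coprime_iff_dvd.1 h
    refine coef_eq_zero_of_dvd ∅ w6 hp hn hpn ?_
    have : p ∣ 2 * 3 := hp6
    have h23 : p = 2 ∨ p = 3 := by
      rcases (Nat.Prime.dvd_mul hp).1 this with h | h
      · exact Or.inl ((Nat.prime_dvd_prime_iff_eq hp Nat.prime_two).1 h)
      · exact Or.inr ((Nat.prime_dvd_prime_iff_eq hp Nat.prime_three).1 h)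
    simp [w6, h23]

theorem sum_coef_six_mul (k : ℕ) : ∑ n ∈ Finset.Icc 1 (6 * k), coef ∅ w6 n = sixSum k := by
  induction k with
  | zero => simp [sixSum]
  | succ k ih =>
    rw [show 6 * (k + 1) = 6 * k + 1 + 1 + 1 + 1 + 1 + 1 by ring]
    iterate 6 rw [Finset.sum_Icc_succ_top (by omega)]
    rw [ih, sixSum, sixSum, Finset.sum_range_succ]
    iterate 6 rw [coef_empty_w6 (by omega)]
    rw [if_pos (by omega), if_neg (by omega), if_neg (by omega), if_neg (by omega),
      if_pos (by omega), if_neg (by omega)]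
    push_cast
    ring

theorem H6_of_mem_left {y : ℝ} {k : ℕ} (h1 : 6 * (k : ℝ) + 1 ≤ y) (h2 : y < 6 * k + 5) :
    H6 y = sixSum k + 1 / (6 * (k : ℝ) + 1) := by
  have hk : (0 : ℝ) ≤ k := k.cast_nonneg
  have hf1 : 6 * k + 1 ≤ ⌊y⌋₊ := Nat.le_floor (by push_cast; linarith)
  have hf2 : ⌊y⌋₊ < 6 * k + 5 := (Nat.floor_lt (by linarith)).2 (by push_cast; linarith)
  unfold H6 wsum
  rw [← sum_coef_six_mul]
  have e1 : ∑ n ∈ Finset.Icc 1 (6 * k + 1), coef ∅ w6 n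
      = ∑ n ∈ Finset.Icc 1 (6 * k), coef ∅ w6 n + 1 / (6 * (k : ℝ) + 1) := by
    rw [Finset.sum_Icc_succ_top (by omega), coef_empty_w6 (by omega),
      if_pos (by omega)]
    push_cast
    ring
  rw [← e1]
  symm
  refine Finset.sum_subset (Finset.Icc_subset_Icc_right hf1) fun n hn hn' => ?_
  simp only [Finset.mem_Icc, not_and, not_le] at hn hn'
  rw [coef_empty_w6 (by omega), if_neg]
  have := hn' hn.1
  omega

theorem H6_of_mem_right {y : ℝ} {k : ℕ} (h1 : 6 * (k : ℝ) - 1 ≤ y) (h2 : y < 6 * k + 1)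
    (hk : 1 ≤ k) : H6 y = sixSum k := by
  have hk' : (1 : ℝ) ≤ k := by exact_mod_cast hk
  obtain ⟨j, rfl⟩ : ∃ j, k = j + 1 := ⟨k - 1, by omega⟩
  have hf1 : 6 * j + 5 ≤ ⌊y⌋₊ := Nat.le_floor (by push_cast at *; linarith)
  have hf2 : ⌊y⌋₊ < 6 * j + 7 := (Nat.floor_lt (by linarith)).2 (by push_cast at *; linarith)
  unfold H6 wsum
  rw [← sum_coef_six_mul, show 6 * (j + 1) = 6 * j + 5 + 1 by ring]
  have e1 : ∑ n ∈ Finset.Icc 1 (6 * j + 5 + 1), coef ∅ w6 n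
      = ∑ n ∈ Finset.Icc 1 (6 * j + 5), coef ∅ w6 n := by
    rw [Finset.sum_Icc_succ_top (by omega), coef_empty_w6 (by omega),
      if_neg (by omega), add_zero]
  rw [e1]
  symm
  refine Finset.sum_subset (Finset.Icc_subset_Icc_right hf1) fun n hn hn' => ?_
  simp only [Finset.mem_Icc, not_and, not_le] at hn hn'
  rw [coef_empty_w6 (by omega), if_neg]
  have := hn' hn.1
  omega

theorem sixSum_eq_harmonic (k : ℕ) : sixSum k = (harmonic (6 * k) : ℝ) - harmonic (3 * k) / 2
    - harmonic (2 * k) / 3 + harmonic k / 6 := by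
  induction k with
  | zero => simp [sixSum]
  | succ k ih =>
    have e : sixSum (k + 1) = sixSum k + (1 / (6 * (k : ℝ) + 1) + 1 / (6 * (k : ℝ) + 5)) := by
      rw [sixSum, Finset.sum_range_succ, ← sixSum]
    rw [e, ih, show 6 * (k + 1) = 6 * k + 1 + 1 + 1 + 1 + 1 + 1 by ring,
      show 3 * (k + 1) = 3 * k + 1 + 1 + 1 by ring, show 2 * (k + 1) = 2 * k + 1 + 1 by ring]
    simp only [harmonic_succ]
    push_cast
    rw [show 6 * (k : ℝ) + 1 + 1 = 2 * (3 * k + 1) by ring,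
      show 6 * (k : ℝ) + 2 + 1 = 3 * (2 * k + 1) by ring,
      show 6 * (k : ℝ) + 3 + 1 = 2 * (3 * k + 1 + 1) by ring,
      show 6 * (k : ℝ) + 4 + 1 = 6 * k + 5 by ring,
      show 6 * (k : ℝ) + 5 + 1 = 6 * (k + 1) by ring,
      show 3 * (k : ℝ) + 2 + 1 = 3 * (k + 1) by ring,
      show 2 * (k : ℝ) + 1 + 1 = 2 * (k + 1) by ring]
    simp only [mul_inv]
    ring

theorem tendsto_sixSum : Filter.Tendsto (fun k : ℕ => sixSum k - Real.log (6 * k) / 3) Filter.atTop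
    (nhds (κ0 / 3)) := by
  have h := Real.tendsto_harmonic_sub_log
  have hm : ∀ c : ℕ, 0 < c → Filter.Tendsto (fun k : ℕ => c * k) Filter.atTop Filter.atTop :=
    fun c hc => Filter.tendsto_id.const_mul_atTop' hc
  have h6 := h.comp (hm 6 (by norm_num))
  have h3 := h.comp (hm 3 (by norm_num))
  have h2 := h.comp (hm 2 (by norm_num))
  have H := (((h6.sub (h3.div_const 2)).sub (h2.div_const 3)).add (h.div_const 6)).add_const
    ((Real.log 2 + Real.log 3 / 2) / 3)
  have e : Real.eulerMascheroniConstant - Real.eulerMascheroniConstant / 2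
      - Real.eulerMascheroniConstant / 3 + Real.eulerMascheroniConstant / 6
      + (Real.log 2 + Real.log 3 / 2) / 3 = κ0 / 3 := by
    unfold κ0; ring
  rw [e] at H
  refine H.congr' ?_
  filter_upwards [Filter.eventually_ge_atTop 1] with k hk
  have hk0 : (k : ℝ) ≠ 0 := by positivity
  simp only [Function.comp]
  rw [sixSum_eq_harmonic]
  push_cast
  rw [show (6 : ℝ) = 2 * 3 by norm_num, Real.log_mul (by norm_num) hk0,
    Real.log_mul (by norm_num) hk0, Real.log_mul (by norm_num) hk0,
    Real.log_mul (by norm_num) (by norm_num)]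
  ring

/-- Up to its limit the sequence `sixSum k - log (6 k) / 3` increases, and it decreases after
adding `1 / (200 k ^ 2)`; this encloses it on both sides. -/
theorem sixSum_step (k : ℕ) (hk : 1 ≤ k) :
    sixSum k - Real.log (6 * k) / 3 ≤ sixSum (k + 1) - Real.log (6 * (k + 1 : ℕ)) / 3 ∧
    sixSum (k + 1) - Real.log (6 * (k + 1 : ℕ)) / 3 + 1 / (200 * ((k + 1 : ℕ) : ℝ) ^ 2)
      ≤ sixSum k - Real.log (6 * k) / 3 + 1 / (200 * (k : ℝ) ^ 2) := by
  have hk' : (1 : ℝ) ≤ k := by exact_mod_cast hk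
  have e : sixSum (k + 1) = sixSum k + (1 / (6 * (k : ℝ) + 1) + 1 / (6 * (k : ℝ) + 5)) := by
    rw [sixSum, Finset.sum_range_succ, ← sixSum]
  have el : Real.log (6 * (k + 1 : ℕ)) = Real.log (6 * k) + Real.log ((k + 1) / k) := by
    rw [← Real.log_mul (by positivity) (by positivity)]
    congr 1
    push_cast
    field_simp
  have hl := log_ratio_lower (a := (k : ℝ)) (b := k + 1) (by linarith) (by linarith)
  have hu := log_ratio_upper (a := (k : ℝ)) (b := k + 1) (by linarith) (by linarith)
  rw [show (k : ℝ) + 1 - k = 1 by ring, show (k : ℝ) + (k + 1) = 2 * k + 1 by ring] at hl hu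
  rw [e, el]
  push_cast
  generalize (k : ℝ) = x at *
  constructor
  · have : (2 * (1 / (2 * x + 1)) + 2 / 3 * (1 / (2 * x + 1)) ^ 3
        + 2 * (1 / (2 * x + 1)) ^ 5 / (1 - (1 / (2 * x + 1)) ^ 2)) / 3
        ≤ 1 / (6 * x + 1) + 1 / (6 * x + 5) := by
      obtain ⟨t, ht, rfl⟩ : ∃ t : ℝ, 0 ≤ t ∧ x = 1 + t := ⟨x - 1, by linarith, by ring⟩
      have : 1 - (1 / (2 * (1 + t) + 1)) ^ 2 = 4 * (1 + t) * (2 + t) / (2 * (1 + t) + 1) ^ 2 := by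
        field_simp; ring
      rw [this, div_add_div _ _ (by positivity) (by positivity)]
      field_simp
      rw [← sub_nonneg]
      ring_nf
      positivity
    linarith
  · have : 1 / (6 * x + 1) + 1 / (6 * x + 5) + 1 / (200 * (x + 1) ^ 2)
        ≤ (2 * (1 / (2 * x + 1)) + 2 / 3 * (1 / (2 * x + 1)) ^ 3) / 3
          + 1 / (200 * x ^ 2) := by
      obtain ⟨t, ht, rfl⟩ : ∃ t : ℝ, 0 ≤ t ∧ x = 1 + t := ⟨x - 1, by linarith, by ring⟩
      rw [div_add_div _ _ (by positivity) (by positivity),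
        div_add_div _ _ (by positivity) (by positivity)]
      field_simp
      rw [← sub_nonneg]
      ring_nf
      positivity
    linarith

theorem sixSum_le {k : ℕ} (hk : 1 ≤ k) : sixSum k ≤ (Real.log (6 * k) + κ0) / 3 := by
  have hm : Monotone (fun n : ℕ => sixSum (n + 1) - Real.log (6 * (n + 1 : ℕ)) / 3) :=
    monotone_nat_of_le_succ fun n => (sixSum_step (n + 1) (by omega)).1
  have := hm.ge_of_tendsto ((Filter.tendsto_add_atTop_iff_nat 1).2 tendsto_sixSum) (k - 1)
  simp only [Nat.sub_add_cancel hk] at this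
  linarith

theorem le_sixSum {k : ℕ} (hk : 1 ≤ k) :
    (Real.log (6 * k) + κ0) / 3 - 1 / (200 * (k : ℝ) ^ 2) ≤ sixSum k := by
  have hm : Antitone (fun n : ℕ => sixSum (n + 1) - Real.log (6 * (n + 1 : ℕ)) / 3
      + 1 / (200 * ((n + 1 : ℕ) : ℝ) ^ 2)) :=
    antitone_nat_of_succ_le fun n => (sixSum_step (n + 1) (by omega)).2
  have h0 : Filter.Tendsto (fun k : ℕ => 1 / (200 * (k : ℝ) ^ 2)) Filter.atTop (nhds 0) := by
    have := (tendsto_inv_atTop_zero.comp (tendsto_natCast_atTop_atTop (R := ℝ))).pow 2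
    have := this.const_mul (1 / 200)
    simp only [ne_eq, OfNat.ofNat_ne_zero, not_false_eq_true, zero_pow, mul_zero] at this
    refine this.congr fun k => ?_
    simp
    ring
  have ht := (tendsto_sixSum.add h0)
  rw [add_zero] at ht
  have := hm.le_of_tendsto ((Filter.tendsto_add_atTop_iff_nat 1).2 ht) (k - 1)
  simp only [Nat.sub_add_cancel hk] at this
  linarith

/-- The error term of `H6`. -/
noncomputable def ε6 (y : ℝ) : ℝ := H6 y - (Real.log y + κ0) / 3

theorem κ0_bounds : 1.8181 < κ0 ∧ κ0 < 1.8199 := by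
  have h1 := sixSum_le (k := 3) (by norm_num)
  have h2 := le_sixSum (k := 3) (by norm_num)
  have e : Real.log (6 * ((3 : ℕ) : ℝ)) = Real.log 2 + 2 * Real.log 3 := by
    rw [show (6 * ((3 : ℕ) : ℝ)) = 2 * 3 ^ 2 by norm_num, Real.log_mul (by norm_num) (by norm_num),
      Real.log_pow]
    norm_num
  have e3 : sixSum 3 = 1 + 1 / 5 + 1 / 7 + 1 / 11 + 1 / 13 + 1 / 17 := by
    norm_num [sixSum, Finset.sum_range_succ]
  rw [e, e3] at h1 h2
  norm_num at h1 h2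
  have := Real.log_two_gt_d9
  have := Real.log_two_lt_d9
  have := Real.log_three_gt_d9
  have := Real.log_three_lt_d9
  constructor <;> norm_num <;> linarith

theorem ε6_of_lt_one {y : ℝ} (hy : y < 1) : ε6 y = -((Real.log y + κ0) / 3) := by
  rw [ε6, H6, wsum_of_lt_one _ _ hy]
  ring

/-- The supremum of `y * |ε6 y|` on `[1, ∞)` is about `0.715`, approached as `y → 5`. The proof
compares `y` with the nearest multiple `x = 6 k`, where `ε6` is `O(1 / x ^ 2)`. -/
theorem abs_ε6_le {y : ℝ} (hy : 1 ≤ y) : |ε6 y| ≤ 0.75 / y := by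
  have hy0 : 0 < y := by linarith
  rw [le_div_iff₀ hy0, ← abs_of_pos hy0, ← abs_mul, abs_of_pos hy0, abs_le]
  obtain ⟨hκ1, hκ2⟩ := κ0_bounds
  set k := ⌊(y + 1) / 6⌋₊ with hk
  have h1 : (k : ℝ) ≤ (y + 1) / 6 := Nat.floor_le (by positivity)
  have h2 : (y + 1) / 6 < k + 1 := Nat.lt_floor_add_one _
  rcases Nat.eq_zero_or_pos k with hk0 | hk0
  · rw [hk0] at h1 h2
    have hH : H6 y = 1 := by
      rw [H6_of_mem_left (k := 0) (by simpa using hy) (by push_cast at *; linarith)]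
      simp [sixSum]
    rw [ε6, hH]
    have hy5 : y < 5 := by push_cast at h2; linarith
    have l1 : Real.log y ≤ 1.6095 + (y - 5) / 5 := by
      have : Real.log y = Real.log 5 + Real.log (y / 5) := by
        rw [← Real.log_mul (by norm_num) (by positivity)]
        congr 1
        field_simp
      rw [this]
      have := Real.log_five_lt_d9
      have := Real.log_le_sub_one_of_pos (show 0 < y / 5 by positivity)
      linarith
    have l2 : 1 - 1 / y ≤ Real.log y := by
      simpa using Real.one_sub_inv_le_log_of_pos hy0
    have l2' : y - 1 ≤ y * Real.log y := by
      have := mul_le_mul_of_nonneg_left l2 hy0.le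
      have e : y * (1 - 1 / y) = y - 1 := by field_simp
      linarith
    constructor
    · have : (Real.log y + κ0) / 3 - 1 ≤ 0.1432 := by linarith
      nlinarith
    · nlinarith
  · have hkr : (1 : ℝ) ≤ k := by exact_mod_cast hk0
    have s1 := sixSum_le hk0
    have s2 := le_sixSum hk0
    obtain ⟨x, hx⟩ : ∃ x : ℝ, x = 6 * k := ⟨_, rfl⟩
    have e : 1 / (200 * (k : ℝ) ^ 2) = 0.18 / x ^ 2 := by
      rw [hx]; field_simp; norm_num
    rw [e, ← hx] at s2
    rw [← hx] at s1
    have hx6 : 6 ≤ x := by linarith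
    have hx0 : 0 < x := by linarith
    have elog : Real.log y = Real.log x + Real.log (y / x) := by
      rw [← Real.log_mul hx0.ne' (by positivity)]
      congr 1
      field_simp
    have l2 : 1 - x / y ≤ Real.log (y / x) := by
      have := Real.one_sub_inv_le_log_of_pos (show 0 < y / x by positivity)
      simpa using this
    have l2' : y - x ≤ y * Real.log (y / x) := by
      have := mul_le_mul_of_nonneg_left l2 hy0.le
      have e : y * (1 - x / y) = y - x := by field_simp
      linarith
    by_cases hc : y < 6 * k + 1
    · rw [ε6, H6_of_mem_right (by linarith) hc hk0, elog]
      have l3 := Real.log_le_sub_one_of_pos (show 0 < y / x by positivity)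
      constructor
      · have h3 : y * ((y / x - 1) / 3 + 0.18 / x ^ 2) ≤ 0.75 := by
          have hyx : y ≤ x + 1 := by linarith
          calc y * ((y / x - 1) / 3 + 0.18 / x ^ 2)
              ≤ y * ((1 / x) / 3 + 0.18 / x ^ 2) := by
                gcongr
                rw [div_sub_one hx0.ne']
                gcongr
                linarith
            _ ≤ (x + 1) * ((1 / x) / 3 + 0.18 / x ^ 2) := by gcongr
            _ ≤ 0.75 := by
                rw [show (x + 1) * ((1 / x) / 3 + 0.18 / x ^ 2)
                  = (x + 1) * (x / 3 + 0.18) / x ^ 2 by field_simp, div_le_iff₀ (by positivity)]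
                nlinarith
        have h4 : y * ((Real.log x + Real.log (y / x) + κ0) / 3 - sixSum k)
            ≤ y * ((y / x - 1) / 3 + 0.18 / x ^ 2) := by
          gcongr
          linarith
        linarith
      · have h4 : y * (sixSum k - (Real.log x + Real.log (y / x) + κ0) / 3)
            ≤ y * (- Real.log (y / x) / 3) := by
          gcongr
          linarith
        nlinarith
    · push Not at hc
      rw [ε6, H6_of_mem_left hc (by linarith), elog, ← hx]
      have hx1 : 0 < x + 1 := by linarith
      constructor
      · have lu : Real.log (y / x) ≤ Real.log ((x + 5) / x) :=
          Real.log_le_log (by positivity) (by gcongr; linarith)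
        have lu2 := log_ratio_upper (a := x) (b := x + 5) hx0 (by linarith)
        rw [show x + 5 - x = 5 by ring, show x + (x + 5) = 2 * x + 5 by ring] at lu2
        have h3 : (x + 5) * ((2 * (5 / (2 * x + 5)) + 2 / 3 * (5 / (2 * x + 5)) ^ 3
            + 2 * (5 / (2 * x + 5)) ^ 5 / (1 - (5 / (2 * x + 5)) ^ 2)) / 3 + 0.18 / x ^ 2
            - 1 / (x + 1)) ≤ 0.75 := by
          rw [show 1 - (5 / (2 * x + 5)) ^ 2 = 4 * x * (x + 5) / (2 * x + 5) ^ 2 by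
            field_simp; ring]
          clear * - hx6
          obtain ⟨t, ht, rfl⟩ : ∃ t : ℝ, 0 ≤ t ∧ x = 6 + t := ⟨x - 6, by linarith, by ring⟩
          rw [← sub_nonneg]
          have : (0.75 : ℝ) - (6 + t + 5) * ((2 * (5 / (2 * (6 + t) + 5))
            + 2 / 3 * (5 / (2 * (6 + t) + 5)) ^ 3 + 2 * (5 / (2 * (6 + t) + 5)) ^ 5 /
            (4 * (6 + t) * ((6 + t) + 5) / (2 * (6 + t) + 5) ^ 2)) / 3 + 0.18 / (6 + t) ^ 2
            - 1 / ((6 + t) + 1)) = (0.75 * (18 * (2 * (6 + t) + 5) ^ 3 * (6 + t) ^ 2 * (7 + t))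
              - ((11 + t) * (60 * (2 * (6 + t) + 5) ^ 2 * (6 + t) ^ 2 * (7 + t)
               + 500 * (6 + t) ^ 2 * (7 + t) + 3.24 * (2 * (6 + t) + 5) ^ 3 * (7 + t)
               - 18 * (2 * (6 + t) + 5) ^ 3 * (6 + t) ^ 2) + 9375 * (6 + t) * (7 + t)))
                / (18 * (2 * (6 + t) + 5) ^ 3 * (6 + t) ^ 2 * (7 + t)) := by
            have h11 : 6 + t + 5 ≠ 0 := by positivity
            have h7 : 6 + t + 1 ≠ 0 := by positivity
            field_simp
            ring
          rw [this]
          refine div_nonneg ?_ (by positivity)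
          ring_nf
          positivity
        by_contra hcon
        push Not at hcon
        have h4 : 0.75 < y * ((Real.log x + Real.log (y / x) + κ0) / 3
            - (sixSum k + 1 / (x + 1))) := by linarith
        have h5 : (Real.log x + Real.log (y / x) + κ0) / 3 - (sixSum k + 1 / (x + 1))
            ≤ (2 * (5 / (2 * x + 5)) + 2 / 3 * (5 / (2 * x + 5)) ^ 3
            + 2 * (5 / (2 * x + 5)) ^ 5 / (1 - (5 / (2 * x + 5)) ^ 2)) / 3 + 0.18 / x ^ 2
            - 1 / (x + 1) := by linarith
        have h6 : 0 < (Real.log x + Real.log (y / x) + κ0) / 3 - (sixSum k + 1 / (x + 1)) := by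
          by_contra h
          push Not at h
          nlinarith
        have h7 := mul_le_mul (show y ≤ x + 5 by linarith) h5 h6.le (by linarith)
        linarith
      · have h4 : y * (sixSum k + 1 / (x + 1) - (Real.log x + Real.log (y / x) + κ0) / 3)
            ≤ y * (1 / (x + 1) - Real.log (y / x) / 3) :=
          mul_le_mul_of_nonneg_left (by linarith) hy0.le
        have h5 : y * (1 / (x + 1)) ≤ 1 + (y - (x + 1)) / 3 := by
          rw [mul_one_div, div_le_iff₀ hx1]
          nlinarith
        nlinarith

/-! ### Removing square factors -/

/-- The density of the integers coprime to `6` and free of square factors `p ^ 2`, `p ∈ s`. -/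
noncomputable def α (s : Finset ℕ) : ℝ := 1 / 3 * ∏ p ∈ s, (1 - 1 / (p : ℝ) ^ 2)

/-- The constant that accompanies `log` in the main term `α s * (log y + β s)` of `wsum s w6 y`.
-/
noncomputable def β (s : Finset ℕ) : ℝ := κ0 + ∑ p ∈ s, 2 * Real.log p / ((p : ℝ) ^ 2 - 1)

/-- The error term of `wsum s w6`. -/
noncomputable def E6 (s : Finset ℕ) (y : ℝ) : ℝ := wsum s w6 y - α s * (Real.log y + β s)

theorem E6_empty (y : ℝ) : E6 ∅ y = ε6 y := by
  simp [E6, α, β, ε6, H6]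
  ring

theorem E6_insert (s : Finset ℕ) (hs : ∀ q ∈ s, q.Prime) {p : ℕ} (hp : p.Prime) (hp5 : 5 ≤ p)
    (hps : p ∉ s) {y : ℝ} (hy : 0 < y) :
    E6 (insert p s) y = E6 s y - 1 / (p : ℝ) ^ 2 * E6 s (y / (p : ℝ) ^ 2) := by
  have hp0 : (5 : ℝ) ≤ p := by exact_mod_cast hp5
  have hw : w6 p ^ 2 = 1 / (p : ℝ) ^ 2 := by
    rw [w6, if_neg (by omega), div_pow, one_pow]
  have hne : (p : ℝ) ^ 2 - 1 ≠ 0 := by nlinarith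
  unfold E6
  rw [wsum_insert s hs w6 hp hps, hw, Real.log_div hy.ne' (by positivity), Real.log_pow]
  unfold α β
  rw [Finset.prod_insert hps, Finset.sum_insert hps]
  push_cast
  field_simp
  ring

/-- Iterating `E6_insert` over `s` expresses `E6 s y` as a signed sum of `ε6 (y / d ^ 2) / d ^ 2`
over divisors `d` of `∏ s`; the signs are given up. -/
theorem exists_abs_E6_le (s : Finset ℕ) (hs : ∀ q ∈ s, q.Prime ∧ 5 ≤ q) :
    ∃ D : Finset ℕ, (∀ d ∈ D, 0 < d ∧ d.Coprime 6 ∧ ∀ p, p.Prime → p ∣ d → p ∈ s) ∧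
      ∀ y : ℝ, 0 < y → |E6 s y| ≤ ∑ d ∈ D, |ε6 (y / (d : ℝ) ^ 2)| / (d : ℝ) ^ 2 := by
  induction s using Finset.induction_on with
  | empty =>
    refine ⟨{1}, ?_, ?_⟩
    · intro d hd
      obtain rfl := Finset.mem_singleton.1 hd
      exact ⟨one_pos, by decide, fun p hp h => absurd (Nat.dvd_one.1 h) hp.ne_one⟩
    · intro y _
      simp [E6_empty]
  | insert p s hps ih =>
    obtain ⟨D, hD, hb⟩ := ih fun q hq => hs q (Finset.mem_insert_of_mem hq)
    obtain ⟨hp, hp5⟩ := hs p (Finset.mem_insert_self _ _)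
    have hp0 : (0 : ℝ) < p := by exact_mod_cast hp.pos
    have hdis : Disjoint D (D.image (p * ·)) := by
      rw [Finset.disjoint_left]
      rintro d hd hd'
      obtain ⟨e, _, rfl⟩ := Finset.mem_image.1 hd'
      exact hps ((hD _ hd).2.2 p hp (dvd_mul_right _ _))
    refine ⟨D ∪ D.image (p * ·), ?_, ?_⟩
    · intro d hd
      rcases Finset.mem_union.1 hd with hd | hd
      · exact ⟨(hD d hd).1, (hD d hd).2.1, fun r hr h =>
          Finset.mem_insert_of_mem ((hD d hd).2.2 r hr h)⟩
      · obtain ⟨e, he, rfl⟩ := Finset.mem_image.1 hd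
        obtain ⟨h1, h2, h3⟩ := hD e he
        refine ⟨Nat.mul_pos hp.pos h1, Nat.Coprime.mul_left ?_ h2, fun r hr h => ?_⟩
        · have h2 : ¬ p ∣ 6 := by
            intro h
            have := Nat.le_of_dvd (by norm_num) h
            interval_cases p
            · revert h; decide
            · revert hp; decide
          exact (Nat.Prime.coprime_iff_not_dvd hp).2 h2
        · rcases (Nat.Prime.dvd_mul hr).1 h with h | h
          · rw [(Nat.prime_dvd_prime_iff_eq hr hp).1 h]
            exact Finset.mem_insert_self _ _
          · exact Finset.mem_insert_of_mem (h3 r hr h)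
    · intro y hy
      rw [E6_insert s (fun q hq => (hs q (Finset.mem_insert_of_mem hq)).1) hp hp5 hps hy,
        Finset.sum_union hdis, Finset.sum_image
            (fun a _ b _ h => Nat.eq_of_mul_eq_mul_left hp.pos h)]
      have h1 := hb y hy
      have h2 := hb (y / (p : ℝ) ^ 2) (by positivity)
      have h3 : ∑ d ∈ D, |ε6 (y / ((p * d : ℕ) : ℝ) ^ 2)| / ((p * d : ℕ) : ℝ) ^ 2
          = 1 / (p : ℝ) ^ 2 * ∑ d ∈ D, |ε6 (y / (p : ℝ) ^ 2 / (d : ℝ) ^ 2)| / (d : ℝ) ^ 2 := by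
        rw [Finset.mul_sum]
        refine Finset.sum_congr rfl fun d _ => ?_
        push_cast
        rw [mul_pow, div_div]
        field_simp
      rw [h3]
      calc |E6 s y - 1 / (p : ℝ) ^ 2 * E6 s (y / (p : ℝ) ^ 2)|
          ≤ |E6 s y| + |1 / (p : ℝ) ^ 2 * E6 s (y / (p : ℝ) ^ 2)| := abs_sub _ _
        _ = |E6 s y| + 1 / (p : ℝ) ^ 2 * |E6 s (y / (p : ℝ) ^ 2)| := by
            rw [abs_mul, abs_of_pos (by positivity : 0 < 1 / (p : ℝ) ^ 2)]
        _ ≤ _ := by gcongr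

/-- A majorant by powers of the main term of `H6` on `(0, 1]`, chosen so that the sum over `d`
telescopes and stays close to the true integral. With `u = z / d` it bounds `ε6 (z ^ 2 / d ^ 2)`
for `d > z`. -/
theorem abs_two_log_add_le {u : ℝ} (hu : 0 < u) (hu1 : u ≤ 1) :
    u * (|2 * Real.log u + κ0| / 3) ≤ 0.3125 * √u + 0.3 * u ^ 3 := by
  obtain ⟨hκ1, hκ2⟩ := κ0_bounds
  obtain ⟨v, hv, hv1, rfl⟩ : ∃ v : ℝ, 0 < v ∧ v ≤ 1 ∧ u = v ^ 2 :=
    ⟨√u, by positivity, Real.sqrt_le_one.2 hu1, by rw [Real.sq_sqrt hu.le]⟩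
  rw [Real.sqrt_sq hv.le, Real.log_pow]
  push_cast
  have hl1 := Real.log_le_sub_one_of_pos hu
  rw [Real.log_pow] at hl1
  push_cast at hl1
  have hl2 := Real.one_sub_inv_le_log_of_pos (show 0 < v / (15 / 64) by positivity)
  rw [Real.log_div hv.ne' (by norm_num)] at hl2
  have hl3 : -1.4532 ≤ Real.log (15 / 64) := by
    have h1 := Real.one_sub_inv_le_log_of_pos (show (0 : ℝ) < 15 / 16 by norm_num)
    have h2 : Real.log (15 / 64) = Real.log (15 / 16) - 2 * Real.log 2 := by
      rw [show (15 / 64 : ℝ) = 15 / 16 / 2 ^ 2 by norm_num, Real.log_div (by norm_num)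
          (by norm_num),
        Real.log_pow]
      norm_num
    have := Real.log_two_lt_d9
    norm_num at h1 ⊢
    linarith
  have key : v * (|2 * (2 * Real.log v) + κ0| / 3) ≤ 0.3125 + 0.3 * v ^ 5 := by
    -- The positive part is largest at `v = 1` and is handled by `log u ≤ u - 1`; the negative part
    -- has its maximum near `v = exp (-1 - κ0 / 4)`, so `log` is bounded by its tangent at `15 / 64`.
    rcases abs_cases (2 * (2 * Real.log v) + κ0) with ⟨h, _⟩ | ⟨h, _⟩ <;> rw [h]
    · have h1 : v * ((2 * (2 * Real.log v) + κ0) / 3) ≤ v * ((2 * (v ^ 2 - 1) + 1.8199) / 3) := by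
        gcongr
      nlinarith [mul_nonneg hv.le (sq_nonneg (v ^ 2 - 1)),
        mul_nonneg (sub_nonneg.2 hv1) (sq_nonneg v), sq_nonneg (v ^ 2 - 1),
        mul_nonneg hv.le (sq_nonneg (v - 1)), mul_nonneg hv.le (sub_nonneg.2 hv1)]
    · have e : v * (1 - (v / (15 / 64))⁻¹) = v - 15 / 64 := by field_simp
      have h1 := mul_le_mul_of_nonneg_left hl2 hv.le
      have h2 : 0 ≤ v * (4 * Real.log (15 / 64) + 4 + κ0) :=
        mul_nonneg hv.le (by linarith)
      have h3 : 0 ≤ v ^ 5 := by positivity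
      linarith
  calc v ^ 2 * (|2 * (2 * Real.log v) + κ0| / 3) = v * (v * (|2 * (2 * Real.log v) + κ0| / 3)) := by
        ring
    _ ≤ v * (0.3125 + 0.3 * v ^ 5) := by gcongr
    _ = 0.3125 * v + 0.3 * (v ^ 2) ^ 3 := by ring

/-- The midpoint (convexity) estimate for `x ↦ x ^ (-3/2)` on an interval of length `3`. -/
theorem inv_mul_sqrt_le {x : ℝ} (hx : 3 / 2 < x) :
    1 / (x * √x) ≤ 2 / 3 * (1 / √(x - 3 / 2) - 1 / √(x + 3 / 2)) := by
  set a := √(x - 3 / 2)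
  set b := √(x + 3 / 2)
  set c := √x
  have ha : 0 < a := Real.sqrt_pos.2 (by linarith)
  have hb : 0 < b := Real.sqrt_pos.2 (by linarith)
  have hc : 0 < c := Real.sqrt_pos.2 (by linarith)
  have ha2 : a ^ 2 = x - 3 / 2 := Real.sq_sqrt (by linarith)
  have hb2 : b ^ 2 = x + 3 / 2 := Real.sq_sqrt (by linarith)
  have hc2 : c ^ 2 = x := Real.sq_sqrt (by linarith)
  have hab : a * b ≤ x := by nlinarith [sq_nonneg (a - b)]
  have hs : a + b ≤ 2 * c := by
    refine le_of_sq_le_sq ?_ (by positivity)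
    nlinarith [sq_nonneg (a - b)]
  have e : 2 / 3 * (1 / a - 1 / b) = 2 / (a * b * (a + b)) := by
    field_simp
    nlinarith
  rw [e, div_le_div_iff₀ (by positivity) (by positivity)]
  have := mul_le_mul hab hs (by positivity) (by linarith)
  linarith

/-- The midpoint (convexity) estimate for `x ↦ x ^ (-4)` on an interval of length `3`. -/
theorem inv_pow_four_le {x : ℝ} (hx : 3 / 2 < x) :
    1 / x ^ 4 ≤ 1 / 9 * (1 / (x - 3 / 2) ^ 3 - 1 / (x + 3 / 2) ^ 3) := by
  have ha : 0 < x - 3 / 2 := by linarith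
  have hb : 0 < x + 3 / 2 := by linarith
  have hx0 : 0 < x := by linarith
  have hab : (x - 3 / 2) * (x + 3 / 2) ≤ x ^ 2 := by nlinarith
  have e : 1 / 9 * (1 / (x - 3 / 2) ^ 3 - 1 / (x + 3 / 2) ^ 3)
      = (x ^ 2 + 3 / 4) / ((x - 3 / 2) * (x + 3 / 2)) ^ 3 := by
    rw [mul_pow, div_sub_div _ _ (by positivity) (by positivity), ← mul_div_assoc]
    congr 1
    ring
  rw [e]
  calc 1 / x ^ 4 = x ^ 2 / (x ^ 2) ^ 3 := by field_simp
    _ ≤ (x ^ 2 + 3 / 4) / ((x - 3 / 2) * (x + 3 / 2)) ^ 3 := by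
      gcongr
      linarith

theorem sum_Ico_inv_mul_sqrt_le {J M : ℕ} (hJ : 1 ≤ J) (hJM : J ≤ M) :
    ∑ j ∈ Finset.Ico J M, 1 / ((3 * (j : ℝ) + 1) * √(3 * (j : ℝ) + 1))
      ≤ 2 / 3 * (1 / √(3 * (J : ℝ) - 1 / 2)) := by
  have hJ' : (1 : ℝ) ≤ J := by exact_mod_cast hJ
  have key : ∑ j ∈ Finset.Ico J M, 1 / ((3 * (j : ℝ) + 1) * √(3 * (j : ℝ) + 1))
      ≤ 2 / 3 * (1 / √(3 * (J : ℝ) - 1 / 2)) - 2 / 3 * (1 / √(3 * (M : ℝ) - 1 / 2)) := by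
    induction M, hJM using Nat.le_induction with
    | base => simp
    | succ n hn ih =>
      have hn' : (J : ℝ) ≤ n := by exact_mod_cast hn
      rw [Finset.sum_Ico_succ_top hn]
      have := inv_mul_sqrt_le (x := 3 * (n : ℝ) + 1) (by linarith)
      rw [show 3 * (n : ℝ) + 1 - 3 / 2 = 3 * n - 1 / 2 by ring,
        show 3 * (n : ℝ) + 1 + 3 / 2 = 3 * (n + 1 : ℕ) - 1 / 2 by push_cast; ring] at this
      linarith
  have : 0 ≤ 1 / √(3 * (M : ℝ) - 1 / 2) := by positivity
  linarith

theorem sum_Ico_inv_pow_four_le {J M : ℕ} (hJ : 1 ≤ J) (hJM : J ≤ M) :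
    ∑ j ∈ Finset.Ico J M, 1 / (3 * (j : ℝ) + 1) ^ 4
      ≤ 1 / 9 * (1 / (3 * (J : ℝ) - 1 / 2) ^ 3) := by
  have hJ' : (1 : ℝ) ≤ J := by exact_mod_cast hJ
  have hM' : (J : ℝ) ≤ M := by exact_mod_cast hJM
  have key : ∑ j ∈ Finset.Ico J M, 1 / (3 * (j : ℝ) + 1) ^ 4
      ≤ 1 / 9 * (1 / (3 * (J : ℝ) - 1 / 2) ^ 3) - 1 / 9 * (1 / (3 * (M : ℝ) - 1 / 2) ^ 3) := by
    clear hM'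
    induction M, hJM using Nat.le_induction with
    | base => simp
    | succ n hn ih =>
      have hn' : (J : ℝ) ≤ n := by exact_mod_cast hn
      rw [Finset.sum_Ico_succ_top hn]
      have := inv_pow_four_le (x := 3 * (n : ℝ) + 1) (by linarith)
      rw [show 3 * (n : ℝ) + 1 - 3 / 2 = 3 * n - 1 / 2 by ring,
        show 3 * (n : ℝ) + 1 + 3 / 2 = 3 * (n + 1 : ℕ) - 1 / 2 by push_cast; ring] at this
      linarith
  have : 0 ≤ 1 / (3 * (M : ℝ) - 1 / 2) ^ 3 := by
    have : 0 < 3 * (M : ℝ) - 1 / 2 := by linarith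
    positivity
  linarith

/-- The numerical inequality behind `sum_abs_ε6_le`: with `ρ = 3 J - 1 / 2`, the first summand
comes from the `J` indices `d ≤ z`, the other two from the telescoped tail over `d > z`. -/
theorem normalized_error_le {z ρ : ℝ} (hρ : 5.5 ≤ ρ) (h1 : 0.82 * ρ ≤ z) (h2 : z ≤ 1.4546 * ρ) :
    0.75 * ((ρ + 1 / 2) / 3) / z + 0.3125 * (2 / 3) * √(z / ρ) + 0.3 / 9 * (z / ρ) ^ 3
      ≤ 0.55 := by
  have hρ0 : 0 < ρ := by linarith
  obtain ⟨w, hw⟩ : ∃ w, w = z / ρ := ⟨_, rfl⟩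
  have hz : z = w * ρ := by rw [hw]; field_simp
  have hw1 : 0.82 ≤ w := by rw [hw, le_div_iff₀ hρ0]; exact h1
  have hw2 : w ≤ 1.4546 := by rw [hw, div_le_iff₀ hρ0]; exact h2
  have hw0 : 0 < w := by linarith
  rw [← hw, hz]
  have e1 : 0.75 * ((ρ + 1 / 2) / 3) / (w * ρ) ≤ 0.27273 / w := by
    rw [div_le_div_iff₀ (by positivity) hw0]
    nlinarith
  have e2 : √w ≤ (1 + w) / 2 := by
    rw [Real.sqrt_le_left (by positivity)]
    nlinarith [sq_nonneg (1 - w)]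
  have e3 : 0.27273 / w ≤ 0.55 - 0.3125 * (2 / 3) * ((1 + w) / 2) - 0.3 / 9 * w ^ 3 := by
    rw [div_le_iff₀ hw0]
    have hw12 := mul_nonneg (sub_nonneg.2 hw1) (sub_nonneg.2 hw2)
    nlinarith [hw12, mul_nonneg hw12 (sq_nonneg w), mul_nonneg hw12 hw0.le]
  nlinarith

/-- The integers `1, 5, 7, 11, …` coprime to `6` are enumerated by `d ↦ d / 3` (integer division),
and `d ≥ 3 (d / 3) + 1`. For `d ≤ z` the bound `|ε6 y| ≤ 0.75 / y` is used, for `d > z` the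
majorant `abs_two_log_add_le`. -/
theorem sum_abs_ε6_le (D : Finset ℕ) (hD : ∀ d ∈ D, 0 < d ∧ d.Coprime 6) {z : ℝ} (hz : 5 ≤ z) :
    ∑ d ∈ D, |ε6 (z ^ 2 / (d : ℝ) ^ 2)| / (d : ℝ) ^ 2 ≤ 0.55 / z := by
  have hz0 : 0 < z := by linarith
  set n := ⌊z⌋₊ with hn
  have hnz : (n : ℝ) ≤ z := Nat.floor_le hz0.le
  have hzn : z < n + 1 := Nat.lt_floor_add_one _
  have hn5 : 5 ≤ n := Nat.le_floor (by exact_mod_cast hz)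
  have hmod : ∀ d ∈ D, d % 6 = 1 ∨ d % 6 = 5 := fun d hd => (coprime_six_iff d).1 (hD d hd).2
  have hinj : ∀ a ∈ D, ∀ b ∈ D, a / 3 = b / 3 → a = b := by
    intro a ha b hb h
    have := hmod a ha
    have := hmod b hb
    omega
  -- `J` is the number of positive integers up to `z` that are coprime to `6`.
  set J := (n + 1) / 6 + (n + 5) / 6 with hJ
  have hJ2 : 2 ≤ J := by omega
  have hJn : 3 * J ≤ n + 2 := by omega
  have hnJ : n ≤ 3 * J + 1 := by omega
  have hlow : ∑ d ∈ D.filter (· ≤ n), |ε6 (z ^ 2 / (d : ℝ) ^ 2)| / (d : ℝ) ^ 2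
      ≤ J * (0.75 / z ^ 2) := by
    have hcard : (D.filter (· ≤ n)).card ≤ J := by
      rw [← Finset.card_range J]
      refine Finset.card_le_card_of_injOn (· / 3) ?_ ?_
      · intro d hd
        obtain ⟨hd1, hd2⟩ := Finset.mem_filter.1 (Finset.mem_coe.1 hd)
        have := hmod d hd1
        simp only [Finset.coe_range, Set.mem_Iio]
        omega
      · intro a ha b hb h
        exact hinj a (Finset.mem_filter.1 (Finset.mem_coe.1 ha)).1 b
          (Finset.mem_filter.1 (Finset.mem_coe.1 hb)).1 h
    calc _ ≤ ∑ d ∈ D.filter (· ≤ n), 0.75 / z ^ 2 := by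
          refine Finset.sum_le_sum fun d hd => ?_
          obtain ⟨hd1, hd2⟩ := Finset.mem_filter.1 hd
          have hd0 : (0 : ℝ) < d := by exact_mod_cast (hD d hd1).1
          have hdz : (d : ℝ) ≤ z := le_trans (by exact_mod_cast hd2) hnz
          have h := abs_ε6_le (y := z ^ 2 / (d : ℝ) ^ 2) (by
            rw [one_le_div (by positivity)]; gcongr)
          rw [div_le_iff₀ (by positivity)]
          refine h.trans (le_of_eq ?_)
          field_simp
      _ = (D.filter (· ≤ n)).card * (0.75 / z ^ 2) := by rw [Finset.sum_const, nsmul_eq_mul]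
      _ ≤ _ := by gcongr
  have hJ' : (2 : ℝ) ≤ J := by exact_mod_cast hJ2
  have hhigh : ∑ d ∈ D.filter (¬ · ≤ n), |ε6 (z ^ 2 / (d : ℝ) ^ 2)| / (d : ℝ) ^ 2
      ≤ 0.3125 / √z * (2 / 3 * (1 / √(3 * (J : ℝ) - 1 / 2)))
        + 0.3 * z ^ 2 * (1 / 9 * (1 / (3 * (J : ℝ) - 1 / 2) ^ 3)) := by
    obtain ⟨M, hM⟩ : ∃ M, ∀ d ∈ D, d < M :=
      ⟨D.sup id + 1, fun d hd => Nat.lt_succ_of_le (Finset.le_sup (f := id) hd)⟩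
    calc _ ≤ ∑ d ∈ D.filter (¬ · ≤ n), (fun j : ℕ =>
            0.3125 / √z * (1 / ((3 * (j : ℝ) + 1) * √(3 * (j : ℝ) + 1)))
              + 0.3 * z ^ 2 * (1 / (3 * (j : ℝ) + 1) ^ 4)) (d / 3) := by
          refine Finset.sum_le_sum fun d hd => ?_
          obtain ⟨hd1, hd2⟩ := Finset.mem_filter.1 hd
          have hd0 : (0 : ℝ) < d := by exact_mod_cast (hD d hd1).1
          have hzd : z < d := lt_of_lt_of_le hzn (by exact_mod_cast (by omega : n + 1 ≤ d))
          have hlt : z ^ 2 / (d : ℝ) ^ 2 < 1 := by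
            rw [div_lt_one (by positivity)]; gcongr
          rw [ε6_of_lt_one hlt, abs_neg, abs_div, abs_of_pos (by norm_num : (0 : ℝ) < 3),
            ← div_pow, Real.log_pow]
          have hu := abs_two_log_add_le (u := z / d) (by positivity) (by
            rw [div_le_one hd0]; exact hzd.le)
          push_cast
          have hd3 : 3 * ((d / 3 : ℕ) : ℝ) + 1 ≤ d := by
            have := hmod d hd1
            exact_mod_cast (by omega : 3 * (d / 3) + 1 ≤ d)
          have hj0 : 0 < 3 * ((d / 3 : ℕ) : ℝ) + 1 := by positivity
          calc |2 * Real.log (z / d) + κ0| / 3 / (d : ℝ) ^ 2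
              = (z / d * (|2 * Real.log (z / d) + κ0| / 3)) / (z * d) := by field_simp
            _ ≤ (0.3125 * √(z / d) + 0.3 * (z / d) ^ 3) / (z * d) := by gcongr
            _ = 0.3125 / √z * (1 / (d * √d)) + 0.3 * z ^ 2 * (1 / (d : ℝ) ^ 4) := by
              rw [Real.sqrt_div hz0.le]
              have h1 : z = √z ^ 2 := (Real.sq_sqrt hz0.le).symm
              have h3 : √z ≠ 0 := by positivity
              have h4 : √(d : ℝ) ≠ 0 := by positivity
              rw [add_div]
              congr 1
              · rw [div_mul_div_comm, mul_one, mul_div_assoc', div_div,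
                  div_eq_div_iff (by positivity) (by positivity)]
                linear_combination (-(0.3125 * d * √(d : ℝ))) * h1
              · field_simp
            _ ≤ _ := by gcongr
      _ = ∑ j ∈ (D.filter (¬ · ≤ n)).image (fun d : ℕ => d / 3),
            (0.3125 / √z * (1 / ((3 * (j : ℝ) + 1) * √(3 * (j : ℝ) + 1)))
              + 0.3 * z ^ 2 * (1 / (3 * (j : ℝ) + 1) ^ 4)) := by
          rw [Finset.sum_image]
          intro a ha b hb h
          exact hinj a (Finset.mem_filter.1 (Finset.mem_coe.1 ha)).1 b
            (Finset.mem_filter.1 (Finset.mem_coe.1 hb)).1 h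
      _ ≤ ∑ j ∈ Finset.Ico J (J + M),
            (0.3125 / √z * (1 / ((3 * (j : ℝ) + 1) * √(3 * (j : ℝ) + 1)))
              + 0.3 * z ^ 2 * (1 / (3 * (j : ℝ) + 1) ^ 4)) := by
          refine Finset.sum_le_sum_of_subset_of_nonneg ?_ fun _ _ _ => by positivity
          intro j hj
          obtain ⟨d, hd, rfl⟩ := Finset.mem_image.1 hj
          obtain ⟨hd1, hd2⟩ := Finset.mem_filter.1 hd
          have := hmod d hd1
          have := hM d hd1
          simp only [Finset.mem_Ico]
          omega
      _ ≤ _ := by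
          rw [Finset.sum_add_distrib, ← Finset.mul_sum, ← Finset.mul_sum]
          gcongr
          · exact sum_Ico_inv_mul_sqrt_le (by omega) (by omega)
          · exact sum_Ico_inv_pow_four_le (by omega) (by omega)
  rw [← Finset.sum_filter_add_sum_filter_not D (· ≤ n)]
  refine (add_le_add hlow hhigh).trans ?_
  set ρ := 3 * (J : ℝ) - 1 / 2 with hρ
  have hnr : 3 * (J : ℝ) ≤ n + 2 := by exact_mod_cast hJn
  have hnr2 : (n : ℝ) ≤ 3 * J + 1 := by exact_mod_cast hnJ
  have hρ5 : 5.5 ≤ ρ := by rw [hρ]; linarith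
  have hρ0 : 0 < ρ := by linarith
  have c1 : 0.82 * ρ ≤ z ∧ z ≤ 1.4546 * ρ := by
    rcases Nat.lt_or_ge J 3 with h | h
    · have : J = 2 := by omega
      rw [this] at hρ hnr2
      push_cast at hρ hnr2
      constructor <;> linarith
    · have : (3 : ℝ) ≤ J := by exact_mod_cast h
      constructor <;> linarith
  have h := normalized_error_le hρ5 c1.1 c1.2
  rw [show ρ + 1 / 2 = 3 * J by rw [hρ]; ring, mul_div_cancel_left₀ _ (by norm_num : (3 : ℝ) ≠ 0)]
    at h
  rw [le_div_iff₀ hz0]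
  refine le_trans (le_of_eq ?_) h
  rw [Real.sqrt_div hz0.le]
  have h1 : z = √z ^ 2 := (Real.sq_sqrt hz0.le).symm
  have h3 : √z ≠ 0 := by positivity
  have h4 : √ρ ≠ 0 := by positivity
  have h5 : 0.3125 / √z * (2 / 3 * (1 / √ρ)) * z = 0.3125 * (2 / 3) * (√z / √ρ) := by
    nth_rewrite 2 [h1]
    field_simp
  rw [add_mul, add_mul, h5]
  field_simp
  ring

theorem abs_E6_le_of_ge {s : Finset ℕ} (hs : ∀ q ∈ s, q.Prime ∧ 5 ≤ q) {y : ℝ} (hy : 25 ≤ y) :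
    |E6 s y| ≤ 0.55 / √y := by
  obtain ⟨D, hD, hb⟩ := exists_abs_E6_le s hs
  have hy0 : 0 < y := by linarith
  refine (hb y hy0).trans ?_
  have h := sum_abs_ε6_le D (fun d hd => ⟨(hD d hd).1, (hD d hd).2.1⟩) (z := √y)
    (Real.le_sqrt_of_sq_le (by linarith))
  rwa [Real.sq_sqrt hy0.le] at h

/-! ### Numerical bounds for the main term -/

theorem log_bounds {a b lo hi l u : ℝ} (ha : 0 < a) (hab : a ≤ b) (h1 : lo ≤ Real.log a)
    (h2 : Real.log a ≤ hi)
    (hl : l ≤ lo + (2 * ((b - a) / (a + b)) + 2 / 3 * ((b - a) / (a + b)) ^ 3))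
    (hu : hi + (2 * ((b - a) / (a + b)) + 2 / 3 * ((b - a) / (a + b)) ^ 3
      + 2 * ((b - a) / (a + b)) ^ 5 / (1 - ((b - a) / (a + b)) ^ 2)) ≤ u) :
    l ≤ Real.log b ∧ Real.log b ≤ u := by
  have h3 := log_ratio_lower ha hab
  have h4 := log_ratio_upper ha hab
  have e : Real.log b = Real.log a + Real.log (b / a) := by
    rw [← Real.log_mul ha.ne' (div_ne_zero (by linarith) ha.ne')]
    congr 1
    field_simp
  constructor <;> linarith

theorem log_five_smooth (i j k : ℕ) : Real.log (2 ^ i * 3 ^ j * 5 ^ k)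
    = i * Real.log 2 + j * Real.log 3 + k * Real.log 5 := by
  rw [Real.log_mul (by positivity) (by positivity), Real.log_mul (by positivity) (by positivity),
    Real.log_pow, Real.log_pow, Real.log_pow]

theorem log_smooth_bounds (i j k : ℕ) {l u : ℝ}
    (hl : l ≤ i * 0.6931471803 + j * 1.0986122885 + k * 1.6094379123)
    (hu : i * 0.6931471808 + j * 1.0986122888 + k * 1.6094379126 ≤ u) :
    l ≤ Real.log (2 ^ i * 3 ^ j * 5 ^ k) ∧ Real.log (2 ^ i * 3 ^ j * 5 ^ k) ≤ u := by
  rw [log_five_smooth]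
  have := Real.log_two_gt_d9
  have := Real.log_two_lt_d9
  have := Real.log_three_gt_d9
  have := Real.log_three_lt_d9
  have := Real.log_five_gt_d9
  have := Real.log_five_lt_d9
  have hi : (0 : ℝ) ≤ i := i.cast_nonneg
  have hj : (0 : ℝ) ≤ j := j.cast_nonneg
  have hk : (0 : ℝ) ≤ k := k.cast_nonneg
  constructor
  · refine hl.trans ?_
    gcongr
  · refine le_trans ?_ hu
    gcongr

/-- Logarithm bounds for `b` slightly above the 5-smooth number `2 ^ i * 3 ^ j * 5 ^ k`, from the
known decimals of `log 2`, `log 3`, `log 5` and the `artanh` series. -/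
theorem log_bounds_of_smooth (i j k : ℕ) {b l u : ℝ} (hab : (2 : ℝ) ^ i * 3 ^ j * 5 ^ k ≤ b)
    (hl : l ≤ i * 0.6931471803 + j * 1.0986122885 + k * 1.6094379123
      + (2 * ((b - 2 ^ i * 3 ^ j * 5 ^ k) / (2 ^ i * 3 ^ j * 5 ^ k + b))
      + 2 / 3 * ((b - 2 ^ i * 3 ^ j * 5 ^ k) / (2 ^ i * 3 ^ j * 5 ^ k + b)) ^ 3))
    (hu : i * 0.6931471808 + j * 1.0986122888 + k * 1.6094379126
      + (2 * ((b - 2 ^ i * 3 ^ j * 5 ^ k) / (2 ^ i * 3 ^ j * 5 ^ k + b))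
        + 2 / 3 * ((b - 2 ^ i * 3 ^ j * 5 ^ k) / (2 ^ i * 3 ^ j * 5 ^ k + b)) ^ 3
      + 2 * ((b - 2 ^ i * 3 ^ j * 5 ^ k) / (2 ^ i * 3 ^ j * 5 ^ k + b)) ^ 5
        / (1 - ((b - 2 ^ i * 3 ^ j * 5 ^ k) / (2 ^ i * 3 ^ j * 5 ^ k + b)) ^ 2)) ≤ u) :
    l ≤ Real.log b ∧ Real.log b ≤ u :=
  log_bounds (by positivity) hab (log_smooth_bounds i j k le_rfl le_rfl).1
    (log_smooth_bounds i j k le_rfl le_rfl).2 hl hu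

theorem log_7 : 1.9459 ≤ Real.log 7 ∧ Real.log 7 ≤ 1.94592 :=
  log_bounds_of_smooth 1 1 0 (by norm_num) (by norm_num) (by norm_num)
theorem log_11 : 2.39789 ≤ Real.log 11 ∧ Real.log 11 ≤ 2.3979 :=
  log_bounds_of_smooth 1 0 1 (by norm_num) (by norm_num) (by norm_num)
theorem log_13 : 2.56494 ≤ Real.log 13 ∧ Real.log 13 ≤ 2.56496 :=
  log_bounds_of_smooth 2 1 0 (by norm_num) (by norm_num) (by norm_num)
theorem log_17 : 2.83321 ≤ Real.log 17 ∧ Real.log 17 ≤ 2.83322 :=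
  log_bounds_of_smooth 4 0 0 (by norm_num) (by norm_num) (by norm_num)
theorem log_19 : 2.94443 ≤ Real.log 19 ∧ Real.log 19 ≤ 2.94445 :=
  log_bounds_of_smooth 1 2 0 (by norm_num) (by norm_num) (by norm_num)
theorem log_23 : 3.1354 ≤ Real.log 23 ∧ Real.log 23 ≤ 3.1356 :=
  log_bounds_of_smooth 2 0 1 (by norm_num) (by norm_num) (by norm_num)
theorem log_29 : 3.3672 ≤ Real.log 29 ∧ Real.log 29 ≤ 3.3674 :=
  log_bounds_of_smooth 0 3 0 (by norm_num) (by norm_num) (by norm_num)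
theorem log_31 : 3.4339 ≤ Real.log 31 ∧ Real.log 31 ≤ 3.4341 :=
  log_bounds_of_smooth 1 1 1 (by norm_num) (by norm_num) (by norm_num)
theorem log_37 : 3.6108 ≤ Real.log 37 ∧ Real.log 37 ≤ 3.611 :=
  log_bounds_of_smooth 2 2 0 (by norm_num) (by norm_num) (by norm_num)
theorem log_41 : 3.7135 ≤ Real.log 41 ∧ Real.log 41 ≤ 3.7137 :=
  log_bounds_of_smooth 3 0 1 (by norm_num) (by norm_num) (by norm_num)
theorem log_43 : 3.7611 ≤ Real.log 43 ∧ Real.log 43 ≤ 3.7613 :=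
  log_bounds_of_smooth 3 0 1 (by norm_num) (by norm_num) (by norm_num)
theorem log_47 : 3.8501 ≤ Real.log 47 ∧ Real.log 47 ≤ 3.8503 :=
  log_bounds_of_smooth 0 2 1 (by norm_num) (by norm_num) (by norm_num)
theorem log_53 : 3.97 ≤ Real.log 53 ∧ Real.log 53 ≤ 3.9704 :=
  log_bounds_of_smooth 1 0 2 (by norm_num) (by norm_num) (by norm_num)

/-- The primes `5 ≤ p < N`. -/
def sieveSet (N : ℕ) : Finset ℕ := N.primesBelow.filter (5 ≤ ·)

theorem mem_sieveSet {N p : ℕ} : p ∈ sieveSet N ↔ p < N ∧ p.Prime ∧ 5 ≤ p := by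
  simp [sieveSet, Nat.mem_primesBelow, and_assoc]

theorem sieveSet_prime {N : ℕ} : ∀ q ∈ sieveSet N, q.Prime ∧ 5 ≤ q :=
  fun _ hq => (mem_sieveSet.1 hq).2

/-- The primes from `5` to `47`, whose local factors are evaluated explicitly. -/
def smallPrimes : Finset ℕ := {5, 7, 11, 13, 17, 19, 23, 29, 31, 37, 41, 43, 47}

theorem sieveSet_filter_lt {N : ℕ} (hN : 53 ≤ N) : (sieveSet N).filter (· < 53) = smallPrimes := by
  have h : (sieveSet N).filter (· < 53) = sieveSet 53 := by
    ext p
    simp only [Finset.mem_filter, mem_sieveSet]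
    exact ⟨fun h => ⟨h.2, h.1.2⟩, fun h => ⟨⟨h.1.trans_le hN, h.2⟩, h.1⟩⟩
  rw [h]
  decide

/-- The primes from `53` on lie in the classes `±1` modulo `6`, so that `p ↦ p / 3` is injective
on them and the sum over all `3 j + 1` with `j ≥ 17` is an upper bound. -/
theorem sum_prime_inv_mul_sqrt_le (t : Finset ℕ) (ht : ∀ p ∈ t, p.Prime ∧ 53 ≤ p) :
    ∑ p ∈ t, 1 / ((p : ℝ) * √p) ≤ 0.0939 := by
  have hmod : ∀ p ∈ t, p % 6 = 1 ∨ p % 6 = 5 := by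
    intro p hp
    obtain ⟨h1, h2⟩ := ht p hp
    have h2' : ¬ 2 ∣ p := fun h => by
      have := (Nat.prime_dvd_prime_iff_eq Nat.prime_two h1).1 h; omega
    have h3' : ¬ 3 ∣ p := fun h => by
      have := (Nat.prime_dvd_prime_iff_eq Nat.prime_three h1).1 h; omega
    omega
  have hinj : ∀ a ∈ t, ∀ b ∈ t, a / 3 = b / 3 → a = b := by
    intro a ha b hb h
    have := hmod a ha
    have := hmod b hb
    omega
  obtain ⟨M, hM⟩ : ∃ M, ∀ d ∈ t, d < M :=
    ⟨t.sup id + 1, fun d hd => Nat.lt_succ_of_le (Finset.le_sup (f := id) hd)⟩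
  calc ∑ p ∈ t, 1 / ((p : ℝ) * √p)
      ≤ ∑ p ∈ t, (fun j : ℕ => 1 / ((3 * (j : ℝ) + 1) * √(3 * (j : ℝ) + 1))) (p / 3) := by
        refine Finset.sum_le_sum fun p hp => ?_
        have h3 : 3 * ((p / 3 : ℕ) : ℝ) + 1 ≤ p := by
          have := hmod p hp
          exact_mod_cast (by omega : 3 * (p / 3) + 1 ≤ p)
        have hj0 : 0 < 3 * ((p / 3 : ℕ) : ℝ) + 1 := by positivity
        dsimp only
        gcongr
    _ = ∑ j ∈ t.image (fun d : ℕ => d / 3), 1 / ((3 * (j : ℝ) + 1) * √(3 * (j : ℝ) + 1)) := by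
        rw [Finset.sum_image]
        intro a ha b hb h
        exact hinj a ha b hb h
    _ ≤ ∑ j ∈ Finset.Ico 17 (17 + M), 1 / ((3 * (j : ℝ) + 1) * √(3 * (j : ℝ) + 1)) := by
        refine Finset.sum_le_sum_of_subset_of_nonneg ?_ fun _ _ _ => by positivity
        intro j hj
        obtain ⟨d, hd, rfl⟩ := Finset.mem_image.1 hj
        have := (ht d hd).2
        have := hM d hd
        simp only [Finset.mem_Ico]
        omega
    _ ≤ 2 / 3 * (1 / √(3 * ((17 : ℕ) : ℝ) - 1 / 2)) :=
        sum_Ico_inv_mul_sqrt_le (by norm_num) (by omega)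
    _ ≤ 0.0939 := by
        have : 7.106 ≤ √(3 * ((17 : ℕ) : ℝ) - 1 / 2) := by
          apply Real.le_sqrt_of_sq_le
          norm_num
        calc 2 / 3 * (1 / √(3 * ((17 : ℕ) : ℝ) - 1 / 2)) ≤ 2 / 3 * (1 / 7.106) := by gcongr
          _ ≤ 0.0939 := by norm_num

theorem β_bounds {N : ℕ} (hN : 53 ≤ N) :
    2.184 ≤ β (sieveSet N) ∧ β (sieveSet N) ≤ 2.289 := by
  obtain ⟨hκ1, hκ2⟩ := κ0_bounds
  unfold β
  rw [← Finset.sum_filter_add_sum_filter_not (sieveSet N) (· < 53), sieveSet_filter_lt hN]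
  have htail0 : 0 ≤ ∑ p ∈ (sieveSet N).filter (¬ · < 53), 2 * Real.log p / ((p : ℝ) ^ 2 - 1) := by
    refine Finset.sum_nonneg fun p hp => ?_
    obtain ⟨h1, h2⟩ := Finset.mem_filter.1 hp
    have h53 : (53 : ℝ) ≤ p := by exact_mod_cast not_lt.1 h2
    have := Real.log_nonneg (show (1 : ℝ) ≤ p by linarith)
    have : 0 < (p : ℝ) ^ 2 - 1 := by nlinarith
    positivity
  have htail : ∑ p ∈ (sieveSet N).filter (¬ · < 53), 2 * Real.log p / ((p : ℝ) ^ 2 - 1)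
      ≤ 1.0925 * 0.0939 := by
    refine le_trans ?_ (mul_le_mul_of_nonneg_left (sum_prime_inv_mul_sqrt_le
      ((sieveSet N).filter (¬ · < 53)) fun p hp => ?_) (by norm_num))
    · rw [Finset.mul_sum]
      refine Finset.sum_le_sum fun p hp => ?_
      obtain ⟨h1, h2⟩ := Finset.mem_filter.1 hp
      have h53 : (53 : ℝ) ≤ p := by exact_mod_cast not_lt.1 h2
      have hp0 : (0 : ℝ) < p := by linarith
      have hl : Real.log p ≤ 0.546 * √p := by
        have e : Real.log p = Real.log 53 + 2 * Real.log (√p / √53) := by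
          rw [← Real.sqrt_div hp0.le, Real.log_sqrt (by positivity), Real.log_div hp0.ne'
              (by norm_num)]
          ring
        have h3 := Real.log_le_sub_one_of_pos (show 0 < √p / √53 by positivity)
        have h4 : 7.28 ≤ √53 := Real.le_sqrt_of_sq_le (by norm_num)
        have h5 : √53 ≤ √p := Real.sqrt_le_sqrt h53
        have h6 : 0 < √53 := by linarith
        have h7 : √p / √53 - 1 ≤ (√p - √53) * (25 / 182) := by
          rw [div_sub_one h6.ne', div_eq_mul_inv]
          refine mul_le_mul_of_nonneg_left ?_ (by linarith)
          rw [inv_le_comm₀ h6 (by norm_num)]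
          norm_num at *
          linarith
        have := log_53.2
        rw [e]
        linarith
      have hs : 0 < √(p : ℝ) := by positivity
      have hss : √(p : ℝ) * √p = p := Real.mul_self_sqrt hp0.le
      have hd : 0 < (p : ℝ) ^ 2 - 1 := by nlinarith
      calc 2 * Real.log p / ((p : ℝ) ^ 2 - 1) ≤ 2 * (0.546 * √p) / ((p : ℝ) ^ 2 - 1) := by gcongr
        _ ≤ 1.0925 * (1 / (p * √p)) := by
          rw [mul_one_div, div_le_div_iff₀ hd (by positivity)]
          have : 2 * (0.546 * √(p : ℝ)) * (p * √p) = 1.092 * p ^ 2 := by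
            rw [show 2 * (0.546 * √(p : ℝ)) * (p * √p) = 1.092 * p * (√p * √p) by ring, hss]
            ring
          rw [this]
          nlinarith
    · obtain ⟨h1, h2⟩ := Finset.mem_filter.1 hp
      exact ⟨(mem_sieveSet.1 h1).2.1, not_lt.1 h2⟩
  have hmain : 0.36595 ≤ ∑ p ∈ smallPrimes, 2 * Real.log p / ((p : ℝ) ^ 2 - 1) ∧
      ∑ p ∈ smallPrimes, 2 * Real.log p / ((p : ℝ) ^ 2 - 1) ≤ 0.3661 := by
    unfold smallPrimes
    iterate 12 rw [Finset.sum_insert (by decide)]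
    rw [Finset.sum_singleton]
    push_cast
    have := Real.log_five_gt_d9
    have := Real.log_five_lt_d9
    have := log_7
    have := log_11
    have := log_13
    have := log_17
    have := log_19
    have := log_23
    have := log_29
    have := log_31
    have := log_37
    have := log_41
    have := log_43
    have := log_47
    norm_num at *
    constructor <;> linarith
  norm_num at *
  constructor <;> linarith

theorem primesBelow_eq_insert {N : ℕ} (hN : 4 ≤ N) :
    N.primesBelow = insert 2 (insert 3 (sieveSet N)) := by
  ext p
  simp only [Nat.mem_primesBelow, Finset.mem_insert, mem_sieveSet]
  constructor
  · rintro ⟨h1, h2⟩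
    by_cases h5 : 5 ≤ p
    · exact Or.inr (Or.inr ⟨h1, h2, h5⟩)
    · interval_cases p <;> first
        | exact Or.inl rfl
        | exact Or.inr (Or.inl rfl)
        | exact absurd h2 (by decide)
  · rintro (rfl | rfl | ⟨h1, h2, _⟩)
    · exact ⟨by omega, Nat.prime_two⟩
    · exact ⟨by omega, Nat.prime_three⟩
    · exact ⟨h1, h2⟩

/-- The Euler product of `ζ(2) = π ^ 2 / 6` without its factors at `2` and `3`. -/
theorem tendsto_α : Filter.Tendsto (fun N => α (sieveSet N)) Filter.atTop
    (nhds (3 / Real.pi ^ 2)) := by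
  have hz := hasSum_zeta_two
  let f : ℕ →*₀ ℝ :=
    { toFun := fun n => 1 / (n : ℝ) ^ 2
      map_zero' := by simp
      map_one' := by simp
      map_mul' := by intro a b; push_cast; rw [mul_pow]; field_simp }
  have hf : Summable (‖f ·‖) := by
    have : (fun n => ‖f n‖) = fun n : ℕ => 1 / (n : ℝ) ^ 2 := by
      funext n
      exact abs_of_nonneg (show (0 : ℝ) ≤ 1 / (n : ℝ) ^ 2 by positivity)
    rw [this]
    exact hz.summable
  have h := EulerProduct.eulerProduct_completely_multiplicative hf
  have hs : ∑' n, f n = Real.pi ^ 2 / 6 := hz.tsum_eq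
  rw [hs] at h
  have h2 := (h.inv₀ (div_ne_zero (pow_ne_zero 2 Real.pi_ne_zero) (by norm_num))).const_mul (1 / 2)
  rw [show 1 / 2 * (Real.pi ^ 2 / 6)⁻¹ = 3 / Real.pi ^ 2 by rw [inv_div]; ring] at h2
  refine h2.congr' ?_
  filter_upwards [Filter.eventually_ge_atTop 4] with N hN
  rw [primesBelow_eq_insert hN, Finset.prod_insert (by simp [mem_sieveSet]),
    Finset.prod_insert (by simp [mem_sieveSet]), mul_inv,
    mul_inv, inv_inv, inv_inv, ← Finset.prod_inv_distrib]
  simp only [inv_inv]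
  change 1 / 2 * ((1 - 1 / ((2 : ℕ) : ℝ) ^ 2) * ((1 - 1 / ((3 : ℕ) : ℝ) ^ 2)
    * ∏ p ∈ sieveSet N, (1 - 1 / (p : ℝ) ^ 2))) = α (sieveSet N)
  unfold α
  norm_num
  ring

theorem eventually_α : ∀ᶠ N in Filter.atTop,
    0.3039 ≤ α (sieveSet N) ∧ α (sieveSet N) ≤ 0.3041 := by
  have h1 := Real.pi_gt_d4
  have h2 := Real.pi_lt_d4
  have hp := Real.pi_pos
  have l : 0.3039 < 3 / Real.pi ^ 2 := by
    rw [lt_div_iff₀ (by positivity)]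
    norm_num at *
    nlinarith
  have u : 3 / Real.pi ^ 2 < 0.3041 := by
    rw [div_lt_iff₀ (by positivity)]
    norm_num at *
    nlinarith
  filter_upwards [tendsto_α.eventually_const_lt l, tendsto_α.eventually_lt_const u] with N a b
  exact ⟨a.le, b.le⟩

/-! ### The error term at all scales -/

/-- Piecewise bounds for `√y * |e y|`. A single constant `0.7` would be too large in the
combination over the divisors of `6` in `abs_two_three_combination_le`; the large values occur
only for `y` just below `1`. -/
structure ErrorProfile (e : ℝ → ℝ) : Prop where
  half : ∀ y, 0 < y → y ≤ 1 / 2 → |e y| ≤ 0.35 / √y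
  one : ∀ y, 0 < y → y < 1 → |e y| ≤ 0.7 / √y
  small : ∀ y, 1 ≤ y → y < 25 → |e y| ≤ 0.45 / √y
  large : ∀ y, 25 ≤ y → |e y| ≤ 0.55 / √y

/-- For `y < 1` the sum is empty and the error is the main term itself: its positive part is
controlled by `hlog`, its negative part is at most `0.3041 / 4`. -/
theorem abs_main_le {a b y : ℝ} (ha1 : 0 ≤ a) (ha2 : a ≤ 0.3041) (hb1 : 2.184 ≤ b)
    (hy : 0 < y) (hy1 : y ≤ 1) {c : ℝ} (hc : 0.08 ≤ c)
    (hlog : 0.3041 * ((Real.log y + b) * √y) ≤ c) : |a * (Real.log y + b)| ≤ c / √y := by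
  have hs : 0 < √y := by positivity
  rw [le_div_iff₀ hs, abs_mul, abs_of_nonneg ha1, mul_assoc]
  rcases abs_cases (Real.log y + b) with ⟨h, h0⟩ | ⟨h, h0⟩ <;> rw [h]
  · refine le_trans ?_ hlog
    have : 0 ≤ (Real.log y + b) * √y := by positivity
    gcongr
  · obtain ⟨v, hv, rfl⟩ : ∃ v : ℝ, 0 < v ∧ y = v ^ 2 := ⟨√y, hs, by rw [Real.sq_sqrt hy.le]⟩
    rw [Real.sqrt_sq hv.le, Real.log_pow] at *
    push_cast at *
    have hl2 := Real.one_sub_inv_le_log_of_pos (show 0 < v / (1 / 8) by positivity)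
    rw [Real.log_div hv.ne' (by norm_num)] at hl2
    have h8 : Real.log (1 / 8) = -(3 * Real.log 2) := by
      rw [show (1 / 8 : ℝ) = (2 ^ 3)⁻¹ by norm_num, Real.log_inv, Real.log_pow]
      norm_num
    have := Real.log_two_lt_d9
    have h3 := mul_le_mul_of_nonneg_left hl2 hv.le
    have e : v * (1 - (v / (1 / 8))⁻¹) = v - 1 / 8 := by field_simp
    have h4 : 0 ≤ v * (2 * Real.log (1 / 8) + 2 + b) := by
      refine mul_nonneg hv.le ?_
      rw [h8]
      linarith
    have h5 : -(2 * Real.log v + b) * v ≤ 1 / 4 := by linarith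
    have h6 : 0 ≤ -(2 * Real.log v + b) * v := by
      apply mul_nonneg _ hv.le
      linarith
    nlinarith

theorem coef_w6_of_lt {s : Finset ℕ} (hs : ∀ q ∈ s, q.Prime ∧ 5 ≤ q) {n : ℕ} (hn0 : n ≠ 0)
    (hn : n < 25) : coef s w6 n = coef ∅ w6 n := by
  unfold coef
  rw [if_pos, if_pos (by simp)]
  intro p hp h
  have h1 := Nat.le_of_dvd (by omega) h
  have := (hs p hp).2
  nlinarith

theorem wsum_w6_of_lt {s : Finset ℕ} (hs : ∀ q ∈ s, q.Prime ∧ 5 ≤ q) {y : ℝ} (hy0 : 0 ≤ y)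
    (hy : y < 25) : wsum s w6 y = H6 y := by
  unfold H6 wsum
  refine Finset.sum_congr rfl fun n hn => ?_
  obtain ⟨h1, h2⟩ := Finset.mem_Icc.1 hn
  have h3 : ⌊y⌋₊ < 25 := (Nat.floor_lt hy0).2 (by exact_mod_cast hy)
  exact coef_w6_of_lt hs (by omega) (by omega)

/-- On an interval `[m, m')` without jumps the sum is a constant `H`, and the monotone main term
is controlled by its values at the two ends. -/
theorem abs_sub_main_le {a b y H m m' B l u : ℝ} (ha1 : 0.3039 ≤ a) (ha2 : a ≤ 0.3041)
    (hb1 : 2.184 ≤ b) (hb2 : b ≤ 2.289) (hm : 0 < m) (hmy : m ≤ y) (hym : y < m')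
    (hl : l ≤ Real.log m) (hu : Real.log m' ≤ u) (hl0 : 0 ≤ l)
    (h1 : H - 0.3039 * (l + 2.184) ≤ B) (h2 : 0.3041 * (u + 2.289) - H ≤ B)
    (hB : B ^ 2 * m' ≤ 0.45 ^ 2) :
    |H - a * (Real.log y + b)| ≤ 0.45 / √y := by
  have hy : 0 < y := by linarith
  have hly := Real.log_le_log hm hmy
  have hyu := Real.log_le_log hy hym.le
  have hs : 0 < √y := by positivity
  have h3 : |H - a * (Real.log y + b)| ≤ B := by
    rw [abs_le]
    constructor <;> nlinarith
  rw [le_div_iff₀ hs]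
  calc |H - a * (Real.log y + b)| * √y ≤ B * √y := by gcongr
    _ ≤ 0.45 := by
      refine le_of_sq_le_sq ?_ (by norm_num)
      rw [mul_pow, Real.sq_sqrt hy.le]
      nlinarith [sq_nonneg B]

/-- Below `25` no square of a prime `≥ 5` occurs, and `H6` is constant between the jumps at
`1, 5, 7, 11, 13, 17, 19, 23`. -/
theorem abs_H6_sub_main_le {a b y : ℝ} (ha1 : 0.3039 ≤ a) (ha2 : a ≤ 0.3041)
    (hb1 : 2.184 ≤ b) (hb2 : b ≤ 2.289) (hy : 1 ≤ y) (hy25 : y < 25) :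
    |H6 y - a * (Real.log y + b)| ≤ 0.45 / √y := by
  have hy0 : 0 < y := by linarith
  have hl5 := Real.log_five_gt_d9
  have hl5' := Real.log_five_lt_d9
  by_cases h5 : y < 5
  · have hH : H6 y = 1 := by
      rw [H6_of_mem_left (k := 0) (by simpa using hy) (by simpa using h5)]
      simp [sixSum]
    rw [hH]
    have hs : 0 < √y := by positivity
    have hs1 : 1 ≤ √y := Real.one_le_sqrt.2 hy
    rw [le_div_iff₀ hs, ← abs_of_pos hs, ← abs_mul, abs_le]
    have hlog : 2 * (1 - 1 / √y) ≤ Real.log y := by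
      have := Real.one_sub_inv_le_log_of_pos hs
      rw [Real.log_sqrt hy0.le] at this
      rw [one_div]
      linarith
    have hlog5 := Real.log_le_log hy0 h5.le
    constructor
    · have h1 : a * (Real.log y + b) - 1 ≤ 0.1858 := by nlinarith
      have h2 : √y ≤ 2.24 := by
        rw [Real.sqrt_le_left (by norm_num)]
        norm_num
        linarith
      nlinarith
    · have h1 := mul_le_mul_of_nonneg_left hlog hs.le
      have e : √y * (2 * (1 - 1 / √y)) = 2 * √y - 2 := by field_simp
      rw [e] at h1
      have h2 : 0.3039 * (2 * √y - 2) ≤ a * (√y * Real.log y) :=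
        mul_le_mul ha1 h1 (by linarith) (by linarith)
      have h3 : 0.3039 * 2.184 * √y ≤ a * b * √y := by gcongr
      linarith
  push Not at h5
  have hl7 := log_7
  have hl11 := log_11
  have hl13 := log_13
  have hl17 := log_17
  have hl19 := log_19
  have hl23 := log_23
  have hl25 : Real.log 25 ≤ 3.2189 := by
    rw [show (25 : ℝ) = 5 ^ 2 by norm_num, Real.log_pow]
    push_cast
    linarith
  have k1 := H6_of_mem_right (y := y) (k := 1)
  have k2 := H6_of_mem_left (y := y) (k := 1)
  have k3 := H6_of_mem_right (y := y) (k := 2)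
  have k4 := H6_of_mem_left (y := y) (k := 2)
  have k5 := H6_of_mem_right (y := y) (k := 3)
  have k6 := H6_of_mem_left (y := y) (k := 3)
  have k7 := H6_of_mem_right (y := y) (k := 4)
  norm_num [sixSum, Finset.sum_range_succ] at k1 k2 k3 k4 k5 k6 k7
  rcases lt_or_ge y 7 with h7 | h7
  · rw [k1 h5 h7]
    exact abs_sub_main_le ha1 ha2 hb1 hb2 (by norm_num) h5 h7 hl5.le hl7.2 (by norm_num)
      (B := 0.17) (by norm_num) (by norm_num) (by norm_num)
  rcases lt_or_ge y 11 with h11 | h11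
  · rw [k2 h7 h11]
    exact abs_sub_main_le ha1 ha2 hb1 hb2 (by norm_num) h7 h11 hl7.1 hl11.2 (by norm_num)
      (B := 0.135) (by norm_num) (by norm_num) (by norm_num)
  rcases lt_or_ge y 13 with h13 | h13
  · rw [k3 h11 h13]
    exact abs_sub_main_le ha1 ha2 hb1 hb2 (by norm_num) h11 h13 hl11.1 hl13.2 (by norm_num)
      (B := 0.12) (by norm_num) (by norm_num) (by norm_num)
  rcases lt_or_ge y 17 with h17 | h17
  · rw [k4 h13 h17]
    exact abs_sub_main_le ha1 ha2 hb1 hb2 (by norm_num) h13 h17 hl13.1 hl17.2 (by norm_num)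
      (B := 0.1) (by norm_num) (by norm_num) (by norm_num)
  rcases lt_or_ge y 19 with h19 | h19
  · rw [k5 h17 h19]
    exact abs_sub_main_le ha1 ha2 hb1 hb2 (by norm_num) h17 h19 hl17.1 hl19.2 (by norm_num)
      (B := 0.1) (by norm_num) (by norm_num) (by norm_num)
  rcases lt_or_ge y 23 with h23 | h23
  · rw [k6 h19 h23]
    exact abs_sub_main_le ha1 ha2 hb1 hb2 (by norm_num) h19 h23 hl19.1 hl23.2 (by norm_num)
      (B := 0.09) (by norm_num) (by norm_num) (by norm_num)
  · rw [k7 h23 hy25]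
    exact abs_sub_main_le ha1 ha2 hb1 hb2 (by norm_num) h23 hy25 hl23.1 hl25 (by norm_num)
      (B := 0.09) (by norm_num) (by norm_num) (by norm_num)

theorem errorProfile_E6 {N : ℕ} (hN : 53 ≤ N)
    (hα : 0.3039 ≤ α (sieveSet N) ∧ α (sieveSet N) ≤ 0.3041) :
    ErrorProfile (E6 (sieveSet N)) := by
  obtain ⟨hb1, hb2⟩ := β_bounds hN
  obtain ⟨ha1, ha2⟩ := hα
  have hlt : ∀ y, y < 1 → |E6 (sieveSet N) y|
      = |α (sieveSet N) * (Real.log y + β (sieveSet N))| := by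
    intro y hy
    rw [E6, wsum_of_lt_one _ _ hy, zero_sub, abs_neg]
  refine ⟨fun y hy h => ?_, fun y hy h => ?_, fun y hy h => ?_, fun y hy => ?_⟩
  · rw [hlt y (by linarith)]
    refine abs_main_le (by linarith) ha2 hb1 hy (by linarith) (by norm_num) ?_
    have h1 : Real.log y ≤ -0.69314 := by
      have := Real.log_le_log hy h
      rw [one_div, Real.log_inv] at this
      have := Real.log_two_gt_d9
      linarith
    have h2 : √y ≤ 0.7072 := by
      rw [Real.sqrt_le_left (by norm_num)]
      norm_num
      linarith
    have h3 : (Real.log y + β (sieveSet N)) * √y ≤ 1.59586 * 0.7072 := by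
      calc (Real.log y + β (sieveSet N)) * √y ≤ 1.59586 * √y := by gcongr; linarith
        _ ≤ _ := by gcongr
    linarith
  · rw [hlt y h]
    refine abs_main_le (by linarith) ha2 hb1 hy h.le (by norm_num) ?_
    have h1 : Real.log y ≤ 0 := Real.log_nonpos hy.le h.le
    have h2 : √y ≤ 1 := Real.sqrt_le_one.2 h.le
    have h3 : (Real.log y + β (sieveSet N)) * √y ≤ 2.289 * 1 := by
      calc (Real.log y + β (sieveSet N)) * √y ≤ 2.289 * √y := by gcongr; linarith
        _ ≤ _ := by gcongr
    linarith
  · rw [E6, wsum_w6_of_lt sieveSet_prime (by linarith) h]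
    exact abs_H6_sub_main_le ha1 ha2 hb1 hb2 hy h
  · exact abs_E6_le_of_ge sieveSet_prime hy

/-! ### Changing the local factor at one prime -/

/-- `F X = a (log X + b) + O(1 / √X)` on all of `(0, ∞)`, with explicit constant `C`. -/
def HasLogMain (F : ℝ → ℝ) (a b C : ℝ) : Prop :=
  ∀ X : ℝ, 0 < X → |F X - a * (Real.log X + b)| ≤ C / √X

theorem abs_log_le {y : ℝ} (hy : 0 < y) (hy1 : y ≤ 1) : |Real.log y| ≤ 2 / √y := by
  have hs : 0 < √y := by positivity
  have h := Real.one_sub_inv_le_log_of_pos hs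
  rw [Real.log_sqrt hy.le] at h
  rw [abs_of_nonpos (Real.log_nonpos hy.le hy1), div_eq_mul_inv]
  linarith

/-- Dividing the Dirichlet series of `F` by `1 + p ^ (-1 - s)`. The recursion
`e Y = e_F Y - (1 / p) * e (Y / p)` for the error of `T` is iterated until the argument drops
below `1`, where `T` vanishes; the contributions form a geometric series of ratio `1 / √p`. -/
theorem HasLogMain.of_add_div {F T : ℝ → ℝ} {a b C p : ℝ} (hp : 1 < p)
    (hFT : ∀ X, F X = T X + 1 / p * T (X / p)) (hT : ∀ X, X < 1 → T X = 0)
    (h : HasLogMain F a b C) :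
    HasLogMain T (a * (p / (p + 1))) (b + Real.log p / (p + 1)) (C * (√p / (√p - 1))) := by
  have hp0 : 0 < p := by linarith
  have hsp1 : 1 < √p := Real.lt_sqrt_of_sq_lt (by linarith)
  have hsp : 0 < √p := by linarith
  set a' := a * (p / (p + 1)) with ha'
  set b' := b + Real.log p / (p + 1) with hb'
  intro X hX
  set e : ℝ → ℝ := fun Y => T Y - a' * (Real.log Y + b') with he
  have hC : 0 ≤ C := by
    have := (abs_nonneg _).trans (h 1 one_pos)
    simpa using this
  have hrec : ∀ Y, 0 < Y → e Y = (F Y - a * (Real.log Y + b)) - 1 / p * e (Y / p) := by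
    intro Y hY
    simp only [he, hFT Y, Real.log_div hY.ne' hp0.ne', ha', hb']
    field_simp
    ring
  set r := 1 / √p with hr
  have hr0 : 0 < r := by positivity
  have hr1 : r < 1 := by rw [hr, div_lt_one hsp]; exact hsp1
  have hrp : ∀ Y, 0 < Y → 1 / p * (1 / √(Y / p)) = r * (1 / √Y) := by
    intro Y hY
    have hY' : 0 < √Y := by positivity
    rw [Real.sqrt_div hY.le, hr]
    nth_rewrite 1 [← Real.sq_sqrt hp0.le]
    field_simp
  have hbound : ∀ n : ℕ, ∀ Y, 0 < Y → ∀ c, 0 ≤ c → |e (Y / p ^ n)| ≤ c / √(Y / p ^ n) →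
      |e Y| ≤ (C * (√p / (√p - 1)) + c * r ^ n) / √Y := by
    intro n
    induction n with
    | zero =>
      intro Y hY c hc hY2
      simp only [pow_zero, div_one, mul_one] at hY2 ⊢
      refine hY2.trans ?_
      have : 0 ≤ C * (√p / (√p - 1)) := mul_nonneg hC (div_nonneg hsp.le (by linarith))
      gcongr
      linarith
    | succ n ih =>
      intro Y hY c hc hY2
      have h1 := ih (Y / p) (by positivity) c hc (by
        rw [div_div, ← pow_succ']; exact hY2)
      rw [hrec Y hY]
      calc |F Y - a * (Real.log Y + b) - 1 / p * e (Y / p)|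
          ≤ |F Y - a * (Real.log Y + b)| + |1 / p * e (Y / p)| := abs_sub _ _
        _ = |F Y - a * (Real.log Y + b)| + 1 / p * |e (Y / p)| := by
          rw [abs_mul, abs_of_pos (by positivity : 0 < 1 / p)]
        _ ≤ C / √Y + 1 / p * ((C * (√p / (√p - 1)) + c * r ^ n) / √(Y / p)) := by
          gcongr
          exact h Y hY
        _ = C / √Y + (C * (√p / (√p - 1)) + c * r ^ n) * (1 / p * (1 / √(Y / p))) := by ring
        _ = (C * (1 + √p / (√p - 1) * r) + c * r ^ (n + 1)) / √Y := by
          rw [hrp Y hY]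
          ring
        _ = _ := by
          have : 1 + √p / (√p - 1) * r = √p / (√p - 1) := by
            have : √p - 1 ≠ 0 := by linarith
            rw [hr]
            field_simp
            ring
          rw [this]
  have hsmall : ∀ Y, 0 < Y → Y < 1 → |e Y| ≤ (|a'| * (2 + |b'|)) / √Y := by
    intro Y hY hY1
    have hs : 0 < √Y := by positivity
    have hs1 : √Y ≤ 1 := Real.sqrt_le_one.2 hY1.le
    simp only [he, hT Y hY1, zero_sub, abs_neg, abs_mul]
    rw [mul_div_assoc]
    gcongr
    refine (abs_add_le _ _).trans ?_
    rw [add_div]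
    gcongr
    · exact abs_log_le hY hY1.le
    · rw [le_div_iff₀ hs]
      exact mul_le_of_le_one_right (abs_nonneg _) hs1
  have hlim : Filter.Tendsto
      (fun n : ℕ => (C * (√p / (√p - 1)) + (|a'| * (2 + |b'|)) * r ^ n) / √X) Filter.atTop
      (nhds ((C * (√p / (√p - 1)) + (|a'| * (2 + |b'|)) * 0) / √X)) :=
    (((tendsto_pow_atTop_nhds_zero_of_lt_one hr0.le hr1).const_mul _).const_add _).div_const _
  rw [mul_zero, add_zero] at hlim
  refine ge_of_tendsto hlim ?_
  have hpow := tendsto_pow_atTop_atTop_of_one_lt hp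
  filter_upwards [hpow.eventually_gt_atTop X] with n hn
  have hpn : 0 < p ^ n := by positivity
  exact hbound n X hX _ (by positivity)
    (hsmall _ (by positivity) (by rw [div_lt_one hpn]; exact hn))

/-- Replacing the local factor `1 + p ^ (-1 - s)` by `1 + p ^ (-s) / (p - 1)`. As
`1 / (p - 1) - 1 / p = 1 / (p (p - 1))`, the new error is the old one plus a small multiple of
that of `T`, which costs much less than passing through `T` alone. -/
theorem HasLogMain.add_div {F G T : ℝ → ℝ} {a b C v p : ℝ} (hp : 1 < p)
    (hFT : ∀ X, F X = T X + 1 / p * T (X / p)) (hv : v = 1 / (p - 1))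
    (hGT : ∀ X, G X = T X + v * T (X / p)) (hT : ∀ X, X < 1 → T X = 0)
    (h : HasLogMain F a b C) :
    HasLogMain G (a * (p ^ 2 / (p ^ 2 - 1))) (b - Real.log p / (p * (p + 1)))
      (C * (1 + 1 / ((√p - 1) * (p - 1)))) := by
  have hp0 : 0 < p := by linarith
  have hp1 : 0 < p - 1 := by linarith
  have hsp1 : 1 < √p := Real.lt_sqrt_of_sq_lt (by linarith)
  have hsp : 0 < √p := by linarith
  have hsp' : 0 < √p - 1 := by linarith
  have hT' := HasLogMain.of_add_div hp hFT hT h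
  intro X hX
  have h1 := h X hX
  have h2 := hT' (X / p) (by positivity)
  have e : G X - a * (p ^ 2 / (p ^ 2 - 1)) * (Real.log X + (b - Real.log p / (p * (p + 1))))
      = (F X - a * (Real.log X + b)) + 1 / (p * (p - 1)) * (T (X / p)
        - a * (p / (p + 1)) * (Real.log (X / p) + (b + Real.log p / (p + 1)))) := by
    rw [hGT, hFT, hv, Real.log_div hX.ne' hp0.ne',
      show p ^ 2 - 1 = (p - 1) * (p + 1) by ring]
    field_simp
    ring
  rw [e]
  have hX' : 0 < √X := by positivity
  calc _ ≤ |F X - a * (Real.log X + b)| + |1 / (p * (p - 1)) * (T (X / p)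
        - a * (p / (p + 1)) * (Real.log (X / p) + (b + Real.log p / (p + 1))))| := abs_add_le _ _
    _ ≤ C / √X + 1 / (p * (p - 1)) * (C * (√p / (√p - 1)) / √(X / p)) := by
      rw [abs_mul, abs_of_pos (by positivity : 0 < 1 / (p * (p - 1)))]
      gcongr
    _ = C * (1 + 1 / ((√p - 1) * (p - 1))) / √X := by
      rw [Real.sqrt_div hX.le]
      have key : ∀ s x : ℝ, 1 < s → p = s ^ 2 → 0 < x →
          C / x + 1 / (p * (p - 1)) * (C * (s / (s - 1)) / (x / s))
            = C * (1 + 1 / ((s - 1) * (p - 1))) / x := by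
        rintro s x hs rfl hx
        have h1 : s - 1 ≠ 0 := by linarith
        field_simp
      exact key _ _ hsp1 (Real.sq_sqrt hp0.le).symm hX'

/-! ### The primes 2 and 3 -/

/-- The errors of the sums in which the primes `2` and `3`, respectively `3` only, `2` only, or
none of them are allowed. At most two of the arguments `X`, `X / 2`, `X / 3`, `X / 6` lie in
`(1 / 2, 1)`, where the error is large. -/
theorem abs_two_three_combination_le {e : ℝ → ℝ} (he : ErrorProfile e) {X : ℝ} (hX : 0 < X) :
    |e X + e (X / 2) + 1 / 2 * (e (X / 3) + e (X / 6))| ≤ 2.48 / √X ∧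
    |e X + 1 / 2 * e (X / 3)| ≤ 1.1 / √X ∧ |e X + e (X / 2)| ≤ 1.7 / √X ∧ |e X| ≤ 0.7 / √X := by
  have hs : 0 < √X := by positivity
  have scale : ∀ m r c : ℝ, 0 < m → √m ≤ r → 0 ≤ c → |e (X / m)| ≤ c / √(X / m) →
      |e (X / m)| * √X ≤ c * r := by
    intro m r c hm hr hc h
    rw [Real.sqrt_div hX.le] at h
    have hsm : 0 < √m := by positivity
    calc |e (X / m)| * √X ≤ c / (√X / √m) * √X := by gcongr
      _ = c * √m := by field_simp
      _ ≤ c * r := by gcongr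
  have r2 : √2 ≤ 1.4143 := by rw [Real.sqrt_le_left (by norm_num)]; norm_num
  have r3 : √3 ≤ 1.7321 := by rw [Real.sqrt_le_left (by norm_num)]; norm_num
  have r6 : √6 ≤ 2.4495 := by rw [Real.sqrt_le_left (by norm_num)]; norm_num
  have hone : ∀ c : ℝ, |e X| ≤ c / √X → |e X| * √X ≤ c := fun c h => by
    rwa [le_div_iff₀ hs] at h
  have all : ∀ y, 0 < y → |e y| ≤ 0.7 / √y := by
    intro y hy
    rcases lt_or_ge y 1 with h | h
    · exact he.one y hy h
    · rcases lt_or_ge y 25 with h' | h'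
      · refine (he.small y h h').trans ?_
        gcongr
        norm_num
      · refine (he.large y h').trans ?_
        gcongr
        norm_num
  have ge_one : ∀ y, 1 ≤ y → |e y| ≤ 0.55 / √y := by
    intro y h
    rcases lt_or_ge y 25 with h' | h'
    · refine (he.small y h h').trans ?_
      gcongr
      norm_num
    · exact he.large y h'
  have a1 := hone _ (all X hX)
  have a2 := scale 2 _ _ (by norm_num) r2 (by norm_num) (all (X / 2) (by positivity))
  have t1 : |e X + e (X / 2) + 1 / 2 * (e (X / 3) + e (X / 6))| * √X
      ≤ |e X| * √X + |e (X / 2)| * √X + 1 / 2 * (|e (X / 3)| * √X + |e (X / 6)| * √X) := by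
    have h1 := abs_add_le (e X + e (X / 2)) (1 / 2 * (e (X / 3) + e (X / 6)))
    have h2 := abs_add_le (e X) (e (X / 2))
    have h3 := abs_add_le (e (X / 3)) (e (X / 6))
    rw [abs_mul, abs_of_pos (by norm_num : (0 : ℝ) < 1 / 2)] at h1
    have h4 : |e X + e (X / 2) + 1 / 2 * (e (X / 3) + e (X / 6))|
      ≤ |e X| + |e (X / 2)| + 1 / 2 * (|e (X / 3)| + |e (X / 6)|) := by linarith
    have := mul_le_mul_of_nonneg_right h4 hs.le
    linarith
  have t2 : |e X + 1 / 2 * e (X / 3)| * √X ≤ |e X| * √X + 1 / 2 * (|e (X / 3)| * √X) := by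
    have h1 := abs_add_le (e X) (1 / 2 * e (X / 3))
    rw [abs_mul, abs_of_pos (by norm_num : (0 : ℝ) < 1 / 2)] at h1
    have := mul_le_mul_of_nonneg_right h1 hs.le
    linarith
  refine ⟨?_, ?_, ?_, all X hX⟩
  · rw [le_div_iff₀ hs]
    refine t1.trans ?_
    rcases lt_or_ge X 1 with h | h
    · have b2 := scale 2 _ _ (by norm_num) r2 (by norm_num)
        (he.half (X / 2) (by positivity) (by linarith))
      have b3 := scale 3 _ _ (by norm_num) r3 (by norm_num)
        (he.half (X / 3) (by positivity) (by linarith))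
      have b6 := scale 6 _ _ (by norm_num) r6 (by norm_num)
        (he.half (X / 6) (by positivity) (by linarith))
      norm_num at *
      linarith
    rcases lt_or_ge X 3 with h3 | h3
    · have b1 := hone _ (he.small X h (by linarith))
      have b3 := scale 3 _ _ (by norm_num) r3 (by norm_num) (all (X / 3) (by positivity))
      have b6 := scale 6 _ _ (by norm_num) r6 (by norm_num)
        (he.half (X / 6) (by positivity) (by linarith))
      norm_num at *
      linarith
    rcases lt_or_ge X 6 with h6 | h6
    · have b1 := hone _ (he.small X h (by linarith))
      have b2 := scale 2 _ _ (by norm_num) r2 (by norm_num)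
        (he.small (X / 2) (by linarith) (by linarith))
      have b3 := scale 3 _ _ (by norm_num) r3 (by norm_num)
        (he.small (X / 3) (by linarith) (by linarith))
      have b6 := scale 6 _ _ (by norm_num) r6 (by norm_num) (all (X / 6) (by positivity))
      norm_num at *
      linarith
    · have b1 := hone _ (ge_one X h)
      have b2 := scale 2 _ _ (by norm_num) r2 (by norm_num) (ge_one (X / 2) (by linarith))
      have b3 := scale 3 _ _ (by norm_num) r3 (by norm_num) (ge_one (X / 3) (by linarith))
      have b6 := scale 6 _ _ (by norm_num) r6 (by norm_num) (ge_one (X / 6) (by linarith))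
      norm_num at *
      linarith
  · rw [le_div_iff₀ hs]
    refine t2.trans ?_
    rcases lt_or_ge X 1 with h | h
    · have b3 := scale 3 _ _ (by norm_num) r3 (by norm_num)
        (he.half (X / 3) (by positivity) (by linarith))
      norm_num at *
      linarith
    have b1 := hone _ (ge_one X h)
    rcases lt_or_ge X 3 with h3 | h3
    · have b1 := hone _ (he.small X h (by linarith))
      have b3 := scale 3 _ _ (by norm_num) r3 (by norm_num) (all (X / 3) (by positivity))
      norm_num at *
      linarith
    · have b3 := scale 3 _ _ (by norm_num) r3 (by norm_num) (ge_one (X / 3) (by linarith))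
      norm_num at *
      linarith
  · rw [le_div_iff₀ hs]
    have h1 := mul_le_mul_of_nonneg_right (abs_add_le (e X) (e (X / 2))) hs.le
    norm_num at *
    linarith

/-- The weight of `p` in `S q`, namely `1 / φ(p)` for `p ∤ q` and `0` for `p ∣ q`. -/
noncomputable def localWeight (q p : ℕ) : ℝ := if p ∣ q then 0 else 1 / ((p : ℝ) - 1)

/-- The weight function in which the primes of `t` already have their value from `S q` and the
remaining ones still have the value from `w6`. -/
noncomputable def mixedWeight (q : ℕ) (t : Finset ℕ) (p : ℕ) : ℝ :=
  if p ∈ t then localWeight q p else w6 p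

theorem mixedWeight_insert (q : ℕ) (t : Finset ℕ) (p : ℕ) :
    mixedWeight q (insert p t) = Function.update (mixedWeight q t) p (localWeight q p) := by
  funext r
  by_cases h : r = p
  · subst h; simp [mixedWeight]
  · simp [mixedWeight, h]

theorem wsum_mixedWeight_insert (q : ℕ) {s t : Finset ℕ} (hs : ∀ r ∈ s, r.Prime) {p : ℕ}
    (hp : p ∈ s) (X : ℝ) :
    wsum s (mixedWeight q (insert p t)) X = wsum s (Function.update (mixedWeight q t) p 0) X
      + localWeight q p * wsum s (Function.update (mixedWeight q t) p 0) (X / p) := by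
  rw [wsum_eq_update s hs _ hp, mixedWeight_insert]
  simp

theorem wsum_primesBelow_w6 {N : ℕ} (hN : 4 ≤ N) (X : ℝ) :
    wsum N.primesBelow w6 X = wsum (sieveSet N) w6 X := by
  have hs : ∀ q ∈ sieveSet N, q.Prime := fun q hq => (sieveSet_prime q hq).1
  rw [primesBelow_eq_insert hN, wsum_insert _ _ _ Nat.prime_two (by simp [mem_sieveSet]),
    wsum_insert _ hs _ Nat.prime_three (by simp [mem_sieveSet])]
  · simp [w6]
  · intro q hq
    rcases Finset.mem_insert.1 hq with rfl | hq
    · exact Nat.prime_three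
    · exact hs q hq

/-- The error constant after the primes `2` and `3` have received their final weight. -/
noncomputable def baseConst (q : ℕ) : ℝ :=
  if 2 ∣ q then (if 3 ∣ q then 0.7 else 1.1) else (if 3 ∣ q then 1.7 else 2.48)

theorem hasLogMain_two_three (q : ℕ) {N : ℕ} (hN : 53 ≤ N)
    (hα : 0.3039 ≤ α (sieveSet N) ∧ α (sieveSet N) ≤ 0.3041) :
    HasLogMain (wsum N.primesBelow (mixedWeight q {3, 2}))
      (α (sieveSet N) * ((1 + localWeight q 2) * (1 + localWeight q 3)))
      (β (sieveSet N) - localWeight q 2 * Real.log 2 / (1 + localWeight q 2) - localWeight q 3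
          * Real.log 3 / (1 + localWeight q 3))
      (baseConst q) := by
  have he := errorProfile_E6 hN hα
  have hs : ∀ r ∈ N.primesBelow, r.Prime := fun r hr => (Nat.mem_primesBelow.1 hr).2
  have m2 : 2 ∈ N.primesBelow := Nat.mem_primesBelow.2 ⟨by omega, Nat.prime_two⟩
  have m3 : 3 ∈ N.primesBelow := Nat.mem_primesBelow.2 ⟨by omega, Nat.prime_three⟩
  have u3 : Function.update (mixedWeight q {2}) 3 0 = mixedWeight q {2} := by
    rw [Function.update_eq_self_iff]; simp [mixedWeight, w6]
  have u2 : Function.update (mixedWeight q ∅) 2 0 = w6 := by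
    have : mixedWeight q ∅ = w6 := by funext r; simp [mixedWeight]
    rw [this, Function.update_eq_self_iff]; simp [w6]
  have hv2 : localWeight q 2 = if 2 ∣ q then 0 else 1 := by norm_num [localWeight]
  have hv3 : localWeight q 3 = if 3 ∣ q then 0 else 1 / 2 := by norm_num [localWeight]
  intro X hX
  have eX : wsum N.primesBelow (mixedWeight q {3, 2}) X
      - α (sieveSet N) * ((1 + localWeight q 2) * (1 + localWeight q 3)) * (Real.log X
        + (β (sieveSet N) - localWeight q 2 * Real.log 2 / (1 + localWeight q 2)
          - localWeight q 3 * Real.log 3 / (1 + localWeight q 3)))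
      = E6 (sieveSet N) X + localWeight q 2 * E6 (sieveSet N) (X / 2)
        + localWeight q 3 * (E6 (sieveSet N) (X / 3) + localWeight q 2 * E6 (sieveSet N)
            (X / 6)) := by
    have f3 := wsum_mixedWeight_insert q (t := {2}) hs m3
    have f2 := wsum_mixedWeight_insert q (t := ∅) hs m2
    rw [u3] at f3
    rw [u2] at f2
    simp only [insert_empty_eq] at f2
    rw [f3, f2, f2]
    simp only [wsum_primesBelow_w6 (by omega : 4 ≤ N), E6]
    push_cast
    rw [div_div, show (3 : ℝ) * 2 = 6 by norm_num, Real.log_div hX.ne' (by norm_num),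
      Real.log_div hX.ne' (by norm_num), Real.log_div hX.ne' (by norm_num),
      show (6 : ℝ) = 2 * 3 by norm_num, Real.log_mul (by norm_num) (by norm_num)]
    have p2 : 1 + localWeight q 2 ≠ 0 := by rw [hv2]; split_ifs <;> norm_num
    have p3 : 1 + localWeight q 3 ≠ 0 := by rw [hv3]; split_ifs <;> norm_num
    field_simp
    ring
  rw [eX, hv2, hv3]
  obtain ⟨h1, h2, h3, h4⟩ := abs_two_three_combination_le he hX
  unfold baseConst
  split_ifs
  · simpa using h4
  · simpa using h2
  · simpa using h3
  · simpa using h1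

/-! ### The primes from 5 on -/

/-- Factor of the leading coefficient when `p` receives its final weight. -/
noncomputable def mainFactor (q p : ℕ) : ℝ :=
  if p ∣ q then (p : ℝ) / (p + 1) else (p : ℝ) ^ 2 / (p ^ 2 - 1)
/-- Change of the constant next to `log X` when `p` receives its final weight. -/
noncomputable def mainShift (q p : ℕ) : ℝ :=
  if p ∣ q then Real.log p / ((p : ℝ) + 1) else -(Real.log p / ((p : ℝ) * (p + 1)))
/-- Factor of the error constant when `p` receives its final weight. -/
noncomputable def errFactor (q p : ℕ) : ℝ :=
  if p ∣ q then √(p : ℝ) / (√p - 1) else 1 + 1 / ((√(p : ℝ) - 1) * (p - 1))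

theorem HasLogMain.sieve {q N : ℕ} {a b C : ℝ}
    (h : HasLogMain (wsum N.primesBelow (mixedWeight q {3, 2})) a b C)
    (t : Finset ℕ) (ht : t ⊆ sieveSet N) :
    HasLogMain (wsum N.primesBelow (mixedWeight q (t ∪ {3, 2}))) (a * ∏ p ∈ t, mainFactor q p)
        (b + ∑ p ∈ t, mainShift q p)
      (C * ∏ p ∈ t, errFactor q p) := by
  induction t using Finset.induction_on with
  | empty => simpa using h
  | insert p t hpt ih =>
    have hs : ∀ r ∈ N.primesBelow, r.Prime := fun r hr => (Nat.mem_primesBelow.1 hr).2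
    obtain ⟨hpN, hpp, hp5⟩ := mem_sieveSet.1 (ht (Finset.mem_insert_self _ _))
    have hps : p ∈ N.primesBelow := Nat.mem_primesBelow.2 ⟨hpN, hpp⟩
    have ih := ih ((Finset.subset_insert _ _).trans ht)
    have hp1 : (1 : ℝ) < p := by exact_mod_cast hpp.one_lt
    have hpT : p ∉ t ∪ {3, 2} := by
      simp only [Finset.mem_union, Finset.mem_insert, Finset.mem_singleton, not_or]
      exact ⟨hpt, by omega, by omega⟩
    have hw : mixedWeight q (t ∪ {3, 2}) p = 1 / p := by
      rw [mixedWeight, if_neg hpT, w6, if_neg (by omega)]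
    have hF := fun X => wsum_eq_update N.primesBelow hs (mixedWeight q (t ∪ {3, 2})) hps X
    rw [hw] at hF
    have hG := fun X => wsum_mixedWeight_insert q (t := t ∪ {3, 2}) hs hps X
    have h0 : ∀ X < 1, wsum N.primesBelow
        (Function.update (mixedWeight q (t ∪ {3, 2})) p 0) X = 0 :=
      fun X hX => wsum_of_lt_one _ _ hX
    rw [Finset.insert_union, Finset.prod_insert hpt, Finset.prod_insert hpt,
      Finset.sum_insert hpt, mul_comm (mainFactor q p), mul_comm (errFactor q p), add_comm
          (mainShift q p),
      ← mul_assoc, ← mul_assoc, ← add_assoc]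
    by_cases hpq : p ∣ q
    · have hv : localWeight q p = 0 := if_pos hpq
      have hGT : wsum N.primesBelow (mixedWeight q (insert p (t ∪ {3, 2})))
          = wsum N.primesBelow (Function.update (mixedWeight q (t ∪ {3, 2})) p 0) := by
        funext X
        rw [hG, hv, zero_mul, add_zero]
      rw [hGT, mainFactor, mainShift, errFactor, if_pos hpq, if_pos hpq, if_pos hpq]
      exact HasLogMain.of_add_div hp1 hF h0 ih
    · have hv : localWeight q p = 1 / ((p : ℝ) - 1) := if_neg hpq
      rw [mainFactor, mainShift, errFactor, if_neg hpq, if_neg hpq, if_neg hpq, ← sub_eq_add_neg]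
      exact HasLogMain.add_div hp1 hF hv hG h0 ih

theorem primeFactors_eq_filter {q N : ℕ} (hq : q ≠ 0) (hN : q < N) :
    q.primeFactors = N.primesBelow.filter (· ∣ q) := by
  ext p
  simp only [Nat.mem_primeFactors, Finset.mem_filter, Nat.mem_primesBelow]
  constructor
  · rintro ⟨h1, h2, _⟩
    exact ⟨⟨(Nat.le_of_dvd (by omega) h2).trans_lt hN, h1⟩, h2⟩
  · rintro ⟨⟨_, h1⟩, h2⟩
    exact ⟨h1, h2, hq⟩

theorem prod_primeFactors {q N : ℕ} (hq : q ≠ 0) (hN : q < N) (hN4 : 4 ≤ N) (f : ℕ → ℝ) :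
    ∏ p ∈ q.primeFactors, f p = (if 2 ∣ q then f 2 else 1) * ((if 3 ∣ q then f 3 else 1)
      * ∏ p ∈ sieveSet N, if p ∣ q then f p else 1) := by
  rw [primeFactors_eq_filter hq hN, Finset.prod_filter, primesBelow_eq_insert hN4,
    Finset.prod_insert (by simp [mem_sieveSet]), Finset.prod_insert (by simp [mem_sieveSet])]

theorem sum_primeFactors {q N : ℕ} (hq : q ≠ 0) (hN : q < N) (hN4 : 4 ≤ N) (f : ℕ → ℝ) :
    ∑ p ∈ q.primeFactors, f p = (if 2 ∣ q then f 2 else 0) + ((if 3 ∣ q then f 3 else 0)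
      + ∑ p ∈ sieveSet N, if p ∣ q then f p else 0) := by
  rw [primeFactors_eq_filter hq hN, Finset.sum_filter, primesBelow_eq_insert hN4,
    Finset.sum_insert (by simp [mem_sieveSet]), Finset.sum_insert (by simp [mem_sieveSet])]

/-- The local densities multiply up to `φ(q) / q`: for `p ∤ q` the factors `1 - 1 / p ^ 2` and
`p ^ 2 / (p ^ 2 - 1)` cancel. -/
theorem main_coeff_eq {q N : ℕ} (hq : q ≠ 0) (hN : q < N) (hN4 : 4 ≤ N) :
    α (sieveSet N) * ((1 + localWeight q 2) * (1 + localWeight q 3)) *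
        ∏ p ∈ sieveSet N, mainFactor q p
      = (q.totient : ℝ) / q := by
  have h := Nat.totient_eq_mul_prod_factors q
  have h' : (q.totient : ℝ) = q * ∏ p ∈ q.primeFactors, (1 - (p : ℝ)⁻¹) := by
    have h2 := congrArg (fun x : ℚ => (x : ℝ)) h
    push_cast at h2
    exact h2
  have hq0 : (q : ℝ) ≠ 0 := by exact_mod_cast hq
  rw [h', mul_div_cancel_left₀ _ hq0, prod_primeFactors hq hN hN4]
  have e : ∏ p ∈ sieveSet N, (if p ∣ q then 1 - (p : ℝ)⁻¹ else 1)
      = (∏ p ∈ sieveSet N, (1 - 1 / (p : ℝ) ^ 2)) * ∏ p ∈ sieveSet N, mainFactor q p := by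
    rw [← Finset.prod_mul_distrib]
    refine Finset.prod_congr rfl fun p hp => ?_
    have hp5 : (5 : ℝ) ≤ p := by exact_mod_cast (sieveSet_prime p hp).2
    have h1 : (p : ℝ) ^ 2 - 1 ≠ 0 := by nlinarith
    unfold mainFactor
    split_ifs
    · field_simp
      ring
    · field_simp
  rw [e, α, localWeight, localWeight]
  push_cast
  split_ifs <;> ring

/-- The constants next to `log X` add up to a partial sum of the series in `𝔞 q`. -/
theorem main_shift_eq {q N : ℕ} (hq : q ≠ 0) (hN : q < N) (hN4 : 4 ≤ N) :
    β (sieveSet N) - localWeight q 2 * Real.log 2 / (1 + localWeight q 2) - localWeight q 3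
        * Real.log 3 / (1 + localWeight q 3)
      + ∑ p ∈ sieveSet N, mainShift q p
    = (∑ p ∈ N.primesBelow, Real.log p / ((p : ℝ) * (p - 1))) + Real.eulerMascheroniConstant
      + ∑ p ∈ q.primeFactors, Real.log p / (p : ℝ) := by
  rw [sum_primeFactors hq hN hN4, primesBelow_eq_insert hN4,
    Finset.sum_insert (by simp [mem_sieveSet]), Finset.sum_insert (by simp [mem_sieveSet])]
  have e : ∑ p ∈ sieveSet N, 2 * Real.log p / ((p : ℝ) ^ 2 - 1) + ∑ p ∈ sieveSet N, mainShift q p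
      = ∑ p ∈ sieveSet N, Real.log p / ((p : ℝ) * (p - 1))
        + ∑ p ∈ sieveSet N, (if p ∣ q then Real.log p / (p : ℝ) else 0) := by
    rw [← Finset.sum_add_distrib, ← Finset.sum_add_distrib]
    refine Finset.sum_congr rfl fun p hp => ?_
    have hp5 : (5 : ℝ) ≤ p := by exact_mod_cast (sieveSet_prime p hp).2
    have h1 : (p : ℝ) - 1 ≠ 0 := by linarith
    rw [show (p : ℝ) ^ 2 - 1 = (p - 1) * (p + 1) by ring]
    unfold mainShift
    split_ifs <;> field_simp <;> ring
  have e2 : ∑ p ∈ sieveSet N, mainShift q p = ∑ p ∈ sieveSet N, Real.log p / ((p : ℝ) * (p - 1))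
        + ∑ p ∈ sieveSet N, (if p ∣ q then Real.log p / (p : ℝ) else 0)
        - ∑ p ∈ sieveSet N, 2 * Real.log p / ((p : ℝ) ^ 2 - 1) := by linarith
  rw [e2, β, κ0, localWeight, localWeight]
  push_cast
  split_ifs <;> norm_num <;> ring

theorem tendsto_sum_primesBelow {f : ℕ → ℝ} (hf : Summable fun p : Nat.Primes => f p) :
    Filter.Tendsto (fun N : ℕ => ∑ p ∈ N.primesBelow, f p) Filter.atTop
      (nhds (∑' p : Nat.Primes, f p)) := by
  have h : HasSum (Set.indicator {p : ℕ | p.Prime} f) (∑' p : Nat.Primes, f p) :=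
    hasSum_subtype_iff_indicator.1 hf.hasSum
  refine h.tendsto_sum_nat.congr fun N => ?_
  rw [Nat.primesBelow, Finset.sum_filter]
  refine Finset.sum_congr rfl fun p _ => ?_
  simp [Set.indicator_apply]

/-! ### Bounding the error constant -/

/-- The increment of the error constant at a prime `p ∤ q`. -/
noncomputable def η (p : ℕ) : ℝ := 1 / ((√(p : ℝ) - 1) * (p - 1))

/-- The factor of `errConst q` at an odd prime `p ∣ q`; at `p = 2` it is `1`. -/
noncomputable def errConstFactor (p : ℕ) : ℝ :=
  1 + ((p : ℝ) - 2) / ((p : ℝ) ^ (3 / 2 : ℝ) - (p : ℝ) - √(p : ℝ) + 2)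

theorem rpow_three_halves (p : ℕ) : (p : ℝ) ^ (3 / 2 : ℝ) = √(p : ℝ) ^ 3 := by
  rw [Real.sqrt_eq_rpow, ← Real.rpow_natCast, ← Real.rpow_mul p.cast_nonneg]
  norm_num

theorem errConstFactor_denom_pos {p : ℕ} (hp : 2 ≤ p) :
    0 < (p : ℝ) ^ (3 / 2 : ℝ) - (p : ℝ) - √(p : ℝ) + 2 := by
  rw [rpow_three_halves]
  have hp' : (2 : ℝ) ≤ p := by exact_mod_cast hp
  have h1 : 1.4 ≤ √(p : ℝ) := Real.le_sqrt_of_sq_le (by norm_num; linarith)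
  have h2 := Real.sq_sqrt (show (0 : ℝ) ≤ p by linarith)
  generalize √(p : ℝ) = u at *
  rw [← h2]
  nlinarith [pow_nonneg (sub_nonneg.2 h1) 2, pow_nonneg (sub_nonneg.2 h1) 3]

theorem one_le_errConstFactor {p : ℕ} (hp : 2 ≤ p) : 1 ≤ errConstFactor p := by
  have hp' : (2 : ℝ) ≤ p := by exact_mod_cast hp
  have := div_nonneg (sub_nonneg.2 hp') (errConstFactor_denom_pos hp).le
  unfold errConstFactor
  linarith

/-- At `p ∣ q` the factor `√p / (√p - 1)` is exactly `1 + η p` times the factor of `errConst`,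
which explains the shape of `errConst`. -/
theorem errFactor_eq {q p : ℕ} (hp : 2 ≤ p) :
    errFactor q p = (1 + η p) * if p ∣ q then errConstFactor p else 1 := by
  unfold errFactor
  split_ifs
  · have key : ∀ u : ℝ, 1 < u → 0 < u ^ 3 - u ^ 2 - u + 2 → u / (u - 1)
        = (1 + 1 / ((u - 1) * (u ^ 2 - 1))) * (1 + (u ^ 2 - 2) / (u ^ 3 - u ^ 2 - u + 2)) := by
      intro u hu hd
      have h3 : u - 1 ≠ 0 := by linarith
      have h4 : u ^ 2 - 1 ≠ 0 := by nlinarith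
      have h5 := hd.ne'
      rw [one_add_div h5, one_add_div (mul_ne_zero h3 h4), div_mul_div_comm,
        div_eq_div_iff h3 (mul_ne_zero (mul_ne_zero h3 h4) h5)]
      ring
    have hp' : (2 : ℝ) ≤ p := by exact_mod_cast hp
    have h0 := errConstFactor_denom_pos hp
    have h1 : 1 < √(p : ℝ) := Real.lt_sqrt_of_sq_lt (by linarith)
    have h2 := Real.sq_sqrt (show (0 : ℝ) ≤ p by linarith)
    have h3 := key (√(p : ℝ)) h1
    rw [rpow_three_halves] at h0
    rw [h2] at h3
    rw [h3 h0, errConstFactor, η, rpow_three_halves]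
  · rw [mul_one, η]

/-- The infinite product is about `1.632`. The factor at `5` is kept, the others are bounded by
`∏ (1 + η p) ≤ exp (∑ η p)`. -/
theorem prod_one_add_η_le {N : ℕ} (hN : 53 ≤ N) : ∏ p ∈ sieveSet N, (1 + η p) ≤ 1.77 := by
  have hη : ∀ p : ℕ, 2 ≤ p → 0 ≤ η p := by
    intro p hp
    have hp' : (2 : ℝ) ≤ p := by exact_mod_cast hp
    have h1 : 1 < √(p : ℝ) := Real.lt_sqrt_of_sq_lt (by linarith)
    unfold η
    have := mul_pos (sub_pos.2 h1) (show 0 < (p : ℝ) - 1 by linarith)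
    positivity
  have htail : ∑ p ∈ (sieveSet N).filter (¬ · < 53), η p ≤ 0.111 := by
    refine le_trans ?_ ((mul_le_mul_of_nonneg_left (sum_prime_inv_mul_sqrt_le
      ((sieveSet N).filter (¬ · < 53)) fun p hp => ?_)
      (by norm_num : (0 : ℝ) ≤ 1.182)).trans (by norm_num))
    · rw [Finset.mul_sum]
      refine Finset.sum_le_sum fun p hp => ?_
      obtain ⟨h1, h2⟩ := Finset.mem_filter.1 hp
      have h53 : (53 : ℝ) ≤ p := by exact_mod_cast not_lt.1 h2
      have h4 : 7.28 ≤ √(p : ℝ) := Real.le_sqrt_of_sq_le (by norm_num; linarith)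
      have h5 := Real.sq_sqrt (show (0 : ℝ) ≤ p by linarith)
      unfold η
      generalize √(p : ℝ) = u at *
      rw [← h5] at *
      have h6 : 0 < u - 1 := by linarith
      have h7 : 0 < u ^ 2 - 1 := by nlinarith
      rw [mul_one_div, div_le_div_iff₀ (by positivity) (by positivity)]
      nlinarith [pow_nonneg (sub_nonneg.2 h4) 2, pow_nonneg (sub_nonneg.2 h4) 3]
    · obtain ⟨h1, h2⟩ := Finset.mem_filter.1 hp
      exact ⟨(mem_sieveSet.1 h1).2.1, not_lt.1 h2⟩
  have key : ∀ (p : ℕ) (r c : ℝ), 2 ≤ p → 1 < r → r ^ 2 ≤ p → 1 / ((r - 1) * (p - 1)) ≤ c →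
      η p ≤ c := by
    intro p r c hp hr hrp hc
    refine le_trans ?_ hc
    have hp' : (2 : ℝ) ≤ p := by exact_mod_cast hp
    have h1 : r ≤ √(p : ℝ) := Real.le_sqrt_of_sq_le hrp
    have h2 : 0 < r - 1 := by linarith
    have h3 : 0 < (p : ℝ) - 1 := by linarith
    unfold η
    gcongr
  have k5 := key 5 2.236 0.20227 (by norm_num) (by norm_num) (by norm_num) (by norm_num)
  have hsmall : ∑ p ∈ smallPrimes, η p ≤ η 5 + 0.259 := by
    unfold smallPrimes
    iterate 12 rw [Finset.sum_insert (by decide)]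
    rw [Finset.sum_singleton]
    have k7 := key 7 2.645 0.10132 (by norm_num) (by norm_num) (by norm_num) (by norm_num)
    have k11 := key 11 3.316 0.04318 (by norm_num) (by norm_num) (by norm_num) (by norm_num)
    have k13 := key 13 3.605 0.03199 (by norm_num) (by norm_num) (by norm_num) (by norm_num)
    have k17 := key 17 4.123 0.02002 (by norm_num) (by norm_num) (by norm_num) (by norm_num)
    have k19 := key 19 4.358 0.01655 (by norm_num) (by norm_num) (by norm_num) (by norm_num)
    have k23 := key 23 4.795 0.01198 (by norm_num) (by norm_num) (by norm_num) (by norm_num)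
    have k29 := key 29 5.385 0.00815 (by norm_num) (by norm_num) (by norm_num) (by norm_num)
    have k31 := key 31 5.567 0.0073 (by norm_num) (by norm_num) (by norm_num) (by norm_num)
    have k37 := key 37 6.082 0.00547 (by norm_num) (by norm_num) (by norm_num) (by norm_num)
    have k41 := key 41 6.403 0.00463 (by norm_num) (by norm_num) (by norm_num) (by norm_num)
    have k43 := key 43 6.557 0.00429 (by norm_num) (by norm_num) (by norm_num) (by norm_num)
    have k47 := key 47 6.855 0.00372 (by norm_num) (by norm_num) (by norm_num) (by norm_num)
    norm_num at *
    linarith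
  have h5 : 5 ∈ sieveSet N := mem_sieveSet.2 ⟨by omega, by norm_num, le_rfl⟩
  have hsum : ∑ p ∈ (sieveSet N).erase 5, η p ≤ 0.37 := by
    have h1 := Finset.add_sum_erase (sieveSet N) η h5
    rw [← Finset.sum_filter_add_sum_filter_not (sieveSet N) (· < 53), sieveSet_filter_lt hN] at h1
    linarith
  rw [← Finset.mul_prod_erase _ _ h5]
  calc (1 + η 5) * ∏ p ∈ (sieveSet N).erase 5, (1 + η p)
      ≤ (1 + 0.20227) * Real.exp 0.37 := by
        have h2 : ∏ p ∈ (sieveSet N).erase 5, (1 + η p) ≤ Real.exp 0.37 := by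
          refine le_trans (Finset.prod_le_prod (fun p hp => ?_)
            fun p _ => (add_comm 1 (η p)).trans_le (Real.add_one_le_exp (η p))) ?_
          · have := hη p (by have := (sieveSet_prime p (Finset.mem_of_mem_erase hp)).2; omega)
            linarith
          · rw [← Real.exp_sum]
            exact Real.exp_le_exp.2 hsum
        have h3 := hη 5 (by norm_num)
        gcongr
        exact Finset.prod_nonneg fun p hp => by
          have := hη p (by have := (sieveSet_prime p (Finset.mem_of_mem_erase hp)).2; omega)
          linarith
    _ ≤ (1 + 0.20227) * ((1 - 0.37 / 8) ^ 8)⁻¹ := by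
        have h := Real.one_sub_div_pow_le_exp_neg (n := 8) (t := 0.37) (by norm_num)
        rw [Real.exp_neg] at h
        push_cast at h
        gcongr
        rwa [le_inv_comm₀ (Real.exp_pos _) (by norm_num)]
    _ ≤ 1.77 := by norm_num

theorem errConst_eq {q N : ℕ} (hq : q ≠ 0) (hN : q < N) (hN4 : 4 ≤ N) :
    errConst q = (if 3 ∣ q then errConstFactor 3 else 1) *
        (∏ p ∈ sieveSet N, if p ∣ q then errConstFactor p else 1)
      * (4.4 * (if 2 ∣ q then 0.493 else 1)) := by
  have h2 : errConstFactor 2 = 1 := by simp [errConstFactor]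
  unfold errConst
  congr 1
  change ∏ p ∈ q.primeFactors, errConstFactor p = _
  rw [prod_primeFactors hq hN hN4, h2, ite_self, one_mul]

theorem one_le_prod_errConstFactor (q N : ℕ) :
    1 ≤ ∏ p ∈ sieveSet N, if p ∣ q then errConstFactor p else 1 := by
  refine Finset.one_le_prod fun p hp => ?_
  split_ifs
  · exact one_le_errConstFactor (by have := (sieveSet_prime p hp).2; omega)
  · exact le_rfl

theorem le_errConstFactor_three : 1.4 ≤ errConstFactor 3 := by
  unfold errConstFactor
  have h0 := errConstFactor_denom_pos (p := 3) (by norm_num)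
  rw [rpow_three_halves] at h0 ⊢
  push_cast at h0 ⊢
  have h1 : √3 ≤ 1.733 := by rw [Real.sqrt_le_left (by norm_num)]; norm_num
  have h2 : √3 ^ 3 = 3 * √3 := by rw [pow_succ, Real.sq_sqrt (by norm_num)]
  rw [h2] at h0 ⊢
  have : 0.4 ≤ (3 - 2) / (3 * √3 - 3 - √3 + 2) := by
    rw [le_div_iff₀ h0]
    linarith
  linarith

theorem baseConst_mul_prod_le_errConst {q N : ℕ} (hq : q ≠ 0) (hN : q < N) (hN53 : 53 ≤ N) :
    baseConst q * ∏ p ∈ sieveSet N, errFactor q p ≤ errConst q := by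
  rw [errConst_eq hq hN (by omega),
    Finset.prod_congr rfl fun p hp => errFactor_eq (q := q) (p := p)
      (by have := (sieveSet_prime p hp).2; omega), Finset.prod_mul_distrib]
  have h1 := one_le_prod_errConstFactor q N
  have h2 := prod_one_add_η_le hN53
  have h3 := le_errConstFactor_three
  set P := ∏ p ∈ sieveSet N, if p ∣ q then errConstFactor p else 1
  have hb : 0 ≤ baseConst q := by unfold baseConst; split_ifs <;> norm_num
  calc baseConst q * ((∏ p ∈ sieveSet N, (1 + η p)) * P) ≤ baseConst q * (1.77 * P) := by gcongr
    _ = baseConst q * 1.77 * P := by ring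
    _ ≤ ((if 3 ∣ q then 1.4 else 1) * (4.4 * (if 2 ∣ q then 0.493 else 1))) * P := by
      refine mul_le_mul_of_nonneg_right ?_ (by linarith)
      unfold baseConst
      split_ifs <;> norm_num
    _ = (if 3 ∣ q then 1.4 else 1) * P * (4.4 * (if 2 ∣ q then 0.493 else 1)) := by ring
    _ ≤ _ := by
      gcongr
      split_ifs
      · exact h3
      · exact le_rfl

theorem baseConst_two_mul_prod_le {N : ℕ} (hN53 : 53 ≤ N) :
    baseConst 2 * ∏ p ∈ sieveSet N, errFactor 2 p ≤ 2.169 := by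
  have e : ∏ p ∈ sieveSet N, errFactor 2 p = ∏ p ∈ sieveSet N, (1 + η p) := by
    refine Finset.prod_congr rfl fun p hp => ?_
    have h5 := (sieveSet_prime p hp).2
    have : ¬ p ∣ 2 := fun h => by
      have := Nat.le_of_dvd (by norm_num) h
      omega
    rw [errFactor_eq (by omega), if_neg this, mul_one]
  have h2 := prod_one_add_η_le hN53
  rw [e]
  norm_num [baseConst] at *
  linarith

/-! ### Conclusion -/

/-- For every large `N` the sum `S q X` is compared with a main term that contains the partial sum
over `p < N` of the series in `𝔞 q`; then `N → ∞` with `q` and `X` fixed. -/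
theorem abs_S_sub_le {q : ℕ} (hq : q ≠ 0) {C : ℝ}
    (hC : ∀ N : ℕ, q < N → 53 ≤ N → baseConst q * ∏ p ∈ sieveSet N, errFactor q p ≤ C)
    {X : ℝ} (hX : 0 < X) :
    |S q X - (q.totient : ℝ) / q * (Real.log X + 𝔞 q)| ≤ C / √X := by
  have hlim : Filter.Tendsto (fun N : ℕ => |S q X - (q.totient : ℝ) / q * (Real.log X
      + ((∑ p ∈ N.primesBelow, Real.log p / ((p : ℝ) * (p - 1))) + Real.eulerMascheroniConstant
      + ∑ p ∈ q.primeFactors, Real.log p / (p : ℝ)))|) Filter.atTop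
      (nhds |S q X - (q.totient : ℝ) / q * (Real.log X + 𝔞 q)|) := by
    have h := tendsto_sum_primesBelow
      (f := fun p : ℕ => Real.log p / ((p : ℝ) * (p - 1))) summable_log_div
    exact (((((h.add_const _).add_const _).const_add _).const_mul _).const_sub _).abs
  refine le_of_tendsto hlim ?_
  filter_upwards [eventually_α, Filter.eventually_ge_atTop 53, Filter.eventually_gt_atTop q,
    Filter.eventually_gt_atTop ⌊X⌋₊] with N hα hN hqN hXN
  have h := HasLogMain.sieve (hasLogMain_two_three q hN hα) (sieveSet N) subset_rfl
  rw [main_coeff_eq hq hqN (by omega), main_shift_eq hq hqN (by omega)] at h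
  have hS : S q X = wsum N.primesBelow (mixedWeight q (sieveSet N ∪ {3, 2})) X := by
    refine S_eq_wsum q (fun p hp => (Nat.mem_primesBelow.1 hp).2)
      (fun p hp hpX => Nat.mem_primesBelow.2 ⟨by omega, hp⟩) fun p hp => ?_
    rw [mixedWeight, if_pos, localWeight]
    rw [primesBelow_eq_insert (by omega)] at hp
    simp only [Finset.mem_insert, Finset.mem_union, Finset.mem_singleton] at *
    tauto
  rw [hS]
  have hs : 0 < √X := by positivity
  exact (h X hX).trans (by gcongr; exact hC N hqN hN)

theorem errConst_prime_lt {p : ℕ} (hp : p.Prime) : errConst p < 5.9 * j p := by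
  unfold errConst j
  rw [hp.primeFactors, Finset.prod_singleton]
  by_cases h2 : p = 2
  · subst h2
    norm_num
  · have hp3 : 3 ≤ p := by have := hp.two_le; omega
    have hd : ¬ 2 ∣ p := fun h => h2 ((Nat.prime_dvd_prime_iff_eq Nat.prime_two hp).1 h).symm
    rw [if_neg hd, if_neg h2]
    have h0 := errConstFactor_denom_pos (p := p) (by omega)
    have hp' : (3 : ℝ) ≤ p := by exact_mod_cast hp3
    have h1 : 1.73 ≤ √(p : ℝ) := Real.le_sqrt_of_sq_le (by norm_num; linarith)
    have hsq := Real.sq_sqrt (show (0 : ℝ) ≤ p by linarith)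
    rw [rpow_three_halves] at *
    have key : ∀ u : ℝ, 1.73 ≤ u → 0 < u ^ 3 - u ^ 2 - u + 2 →
        (1 + (u ^ 2 - 2) / (u ^ 3 - u ^ 2 - u + 2)) * (4.4 * 1)
          < 5.9 * (1 + (u ^ 2 - 2) / (u ^ 3 - u + 1)) := by
      intro u hu hd
      have hd2 : 0 < u ^ 3 - u + 1 := by nlinarith
      rw [one_add_div hd.ne', one_add_div hd2.ne', ← mul_div_assoc, div_mul_eq_mul_div,
        div_lt_div_iff₀ hd hd2]
      -- With `u = √p`, the difference is a polynomial in `u - 1.73` with positive coefficients.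
      obtain ⟨t, ht, rfl⟩ : ∃ t : ℝ, 0 ≤ t ∧ u = 1.73 + t := ⟨u - 1.73, by linarith, by ring⟩
      rw [← sub_pos]
      ring_nf
      positivity
    have h3 := key _ h1
    rw [hsq] at h3
    exact h3 h0

end SelbergSum

theorem lemma4p6 :
    (∀ (X : ℝ) (q : ℕ), 0 < X → 1 ≤ q →
      |SelbergSum.S q X - (Nat.totient q : ℝ) / (q : ℝ) * (Real.log X + SelbergSum.𝔞 q)|
        ≤ SelbergSum.errConst q / √X) ∧
    (∀ X : ℝ, 0 < X →
      |SelbergSum.S 2 X - 1 / 2 * (Real.log X + SelbergSum.𝔞 2)| ≤ 2.169 / √X) ∧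
    (∀ p : ℕ, p.Prime → SelbergSum.errConst p < 5.9 * SelbergSum.j p) := by
  refine ⟨fun X q hX hq => ?_, fun X hX => ?_, fun p hp => SelbergSum.errConst_prime_lt hp⟩
  · have hq0 : q ≠ 0 := by omega
    exact SelbergSum.abs_S_sub_le hq0
        (fun N h1 h2 => SelbergSum.baseConst_mul_prod_le_errConst hq0 h1 h2) hX
  · have h := SelbergSum.abs_S_sub_le two_ne_zero
      (fun N _ h2 => SelbergSum.baseConst_two_mul_prod_le h2) hX
    rw [Nat.totient_two] at h
    exact_mod_cast h
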